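/- Let $\mathcal H$ be a finite-dimensional complex Hilbert space, let $\mathcal N\subseteq\mathcal B(\mathcal H)$ be a unital $*$-subalgebra that is non-trivial, i.e. $\mathcal N\neq\mathbb C\,\mathbb I$ and $\mathcal N\neq\mathcal B(\mathcal H)$, and let $E_{\mathcal N}:\mathcal B(\mathcal H)\to\mathcal N$ be a faithful conditional expectation, i.e. a completely positive unital contraction with $E_{\mathcal N}[AXB]=A\,E_{\mathcal N}[X]\,B$ for $A,B\in\mathcal N$, such that $X\ge 0$ and $E_{\mathcal N}[X]=0$ imply $X=0$. Let $E_{\mathcal N*}$ be its predual, defined by $\operatorname{Tr}[E_{\mathcal N*}(X)Y]=\operatorname{Tr}[X\,E_{\mathcal N}[Y]]$, and put $\sigma_{\operatorname{Tr}}:=E_{\mathcal N*}(\mathbb I/\dim\mathcal H)$. Write $\|X\|_{s,\sigma_{\operatorname{Tr}}}:=\big(\operatorname{Tr}\big|\sigma_{\operatorname{Tr}}^{1/2s}X\sigma_{\operatorname{Tr}}^{1/2s}\big|^s\big)^{1/s}$ for $1\le s<\infty$, let $\|X\|_{\infty,\sigma_{\operatorname{Tr}}}$ be the operator norm, and for $1\le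 p\le 2$ let $\mathbb L_2(\mathcal N,\mathbb L_p(\sigma_{\operatorname{Tr}}))$ be $\mathcal B(\mathcal H)$ with the norm $$\|Y\|_{(2,p),\mathcal N}:=\sup_{A,B\in\mathcal N\setminus\{0\}}\frac{\|AYB\|_{p,\sigma_{\operatorname{Tr}}}}{\|A\|_{2r,\sigma_{\operatorname{Tr}}}\,\|B\|_{2r,\sigma_{\operatorname{Tr}}}},\qquad \frac1r=\frac1p-\frac12 .$$ Then the spaces $\mathbb L_2(\mathcal N,\mathbb L_p(\sigma_{\operatorname{Tr}}))$, $1\le p\le 2$, do not satisfy the uniform convexity inequality: it is not true that $$\|X\|_{(2,p),\mathcal N}^2\;\ge\;(p-1)\,\|X-E_{\mathcal N}[X]\|_{(2,p),\mathcal N}^2+\|E_{\mathcal N}[X]\|_{(2,p),\mathcal N}^2$$ for all $1\le p\le 2$ and all positive semidefinite $X\in\mathcal B(\mathcal H)$. More precisely, for every $p$ with $1<p<2$ there is a positive semidefinite $X$ for which this inequality fails. -/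

import Mathlib

open scoped ENNReal CStarAlgebra

set_option linter.unusedSectionVars false

noncomputable section

namespace AmalgamatedLp

variable {H : Type*} [NormedAddCommGroup H] [InnerProductSpace ℂ H]
  [FiniteDimensional ℂ H] [CompleteSpace H]

/-- The trace of an operator on a finite-dimensional Hilbert space. -/
def tr : (H →L[ℂ] H) →ₗ[ℂ] ℂ := LinearMap.trace ℂ H ∘ₗ ContinuousLinearMap.coeLM ℂ

/-- A conditional expectation from `B(H)` onto the unital `*`-subalgebra `N`: a completely
positive unital contraction into `N` with `E (A X B) = A (E X) B` for `A, B ∈ N`. -/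
structure IsCondExp (N : StarSubalgebra ℂ (H →L[ℂ] H))
    (E : (H →L[ℂ] H) →CP (H →L[ℂ] H)) : Prop where
  mem : ∀ X, E X ∈ N
  unital : E 1 = 1
  contraction : ∀ X, ‖E X‖ ≤ ‖X‖
  bimodule : ∀ A ∈ N, ∀ B ∈ N, ∀ X, E (A * X * B) = A * E X * B

/-- `E` is faithful: a positive semidefinite `X` with `E X = 0` vanishes. -/
def IsFaithful (E : (H →L[ℂ] H) →CP (H →L[ℂ] H)) : Prop :=
  ∀ X : H →L[ℂ] H, 0 ≤ X → E X = 0 → X = 0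

/-- The predual `E_*` of `E`, written in matrix units of an orthonormal basis; `tr_predual_mul`
and `predual_unique` show that it is the unique operator map with
`Tr (E_* (X) Y) = Tr (X E (Y))`. -/
def predual (E : (H →L[ℂ] H) →CP (H →L[ℂ] H)) (X : H →L[ℂ] H) : H →L[ℂ] H :=
  ∑ i, ∑ j, tr (X * E (InnerProductSpace.rankOne ℂ (stdOrthonormalBasis ℂ H i)
      (stdOrthonormalBasis ℂ H j))) •
    InnerProductSpace.rankOne ℂ (stdOrthonormalBasis ℂ H j) (stdOrthonormalBasis ℂ H i)

theorem tr_mul_rankOne (X : H →L[ℂ] H) (x y : H) :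
    tr (X * InnerProductSpace.rankOne ℂ x y) = inner ℂ y (X x) := by
  have h : X * InnerProductSpace.rankOne ℂ x y = InnerProductSpace.rankOne ℂ (X x) y := by
    ext z; simp
  rw [h, tr, LinearMap.comp_apply, LinearMap.trace_eq_sum_inner _ (stdOrthonormalBasis ℂ H)]
  simp only [ContinuousLinearMap.coeLM_apply, ContinuousLinearMap.coe_coe, InnerProductSpace.rankOne_apply, inner_smul_right]
  exact OrthonormalBasis.sum_inner_mul_inner (stdOrthonormalBasis ℂ H) y (X x)

theorem eq_sum_rankOne (Y : H →L[ℂ] H) :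
    Y = ∑ i, ∑ j, (inner ℂ (stdOrthonormalBasis ℂ H i) (Y (stdOrthonormalBasis ℂ H j))) •
      InnerProductSpace.rankOne ℂ (stdOrthonormalBasis ℂ H i) (stdOrthonormalBasis ℂ H j) := by
  ext z
  simp only [sum_apply, smul_apply,
    InnerProductSpace.rankOne_apply]
  rw [Finset.sum_comm]
  conv_lhs => rw [← (stdOrthonormalBasis ℂ H).sum_repr' z, map_sum]
  refine Finset.sum_congr rfl fun j _ => ?_
  rw [map_smul]
  conv_lhs => rw [← (stdOrthonormalBasis ℂ H).sum_repr' (Y (stdOrthonormalBasis ℂ H j)),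
    Finset.smul_sum]
  exact Finset.sum_congr rfl fun i _ => smul_comm _ _ _

theorem tr_predual_mul (E : (H →L[ℂ] H) →CP (H →L[ℂ] H)) (X Y : H →L[ℂ] H) :
    tr (predual E X * Y) = tr (X * E Y) := by
  conv_lhs => rw [eq_sum_rankOne Y]
  conv_rhs => rw [eq_sum_rankOne Y]
  simp only [map_sum, map_smul, Finset.mul_sum, mul_smul_comm]
  refine Finset.sum_congr rfl fun i _ => Finset.sum_congr rfl fun j _ => ?_
  congr 1
  rw [tr_mul_rankOne, predual]
  simp [sum_apply,
    orthonormal_iff_ite.mp (stdOrthonormalBasis ℂ H).orthonormal]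

theorem predual_unique (E : (H →L[ℂ] H) →CP (H →L[ℂ] H)) (X Z : H →L[ℂ] H)
    (hZ : ∀ Y, tr (Z * Y) = tr (X * E Y)) : Z = predual E X := by
  ext x
  refine ext_inner_left ℂ fun y => ?_
  rw [← tr_mul_rankOne, ← tr_mul_rankOne, hZ, tr_predual_mul]

/-- The reference state `σ_Tr = E_* (1 / dim H)`. -/
def sigmaTr (E : (H →L[ℂ] H) →CP (H →L[ℂ] H)) : H →L[ℂ] H :=
  predual E ((Module.finrank ℂ H : ℂ)⁻¹ • 1)

/-- The weighted norm `‖X‖_{p,σ} = (Tr |σ^{1/(2p)} X σ^{1/(2p)}|^p)^{1/p}` for `1 ≤ p < ∞`, and the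
operator norm for `p = ∞`. -/
def wNorm (σ : H →L[ℂ] H) (p : ℝ≥0∞) (X : H →L[ℂ] H) : ℝ :=
  if p = ∞ then ‖X‖
  else (tr (CFC.abs (σ ^ (1 / (2 * p.toReal)) * X * σ ^ (1 / (2 * p.toReal))) ^
    p.toReal)).re ^ (1 / p.toReal)

/-- The norm `‖Y‖_{(p,q),N}` of `L_p(N, L_q(σ_Tr))` for `1 ≤ q ≤ p ≤ ∞`, namely the supremum over
nonzero `A, B ∈ N` of `‖A Y B‖_{q} / (‖A‖_{2r} ‖B‖_{2r})`, where `1/r = 1/q - 1/p`. -/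
def amalgNorm (N : StarSubalgebra ℂ (H →L[ℂ] H)) (E : (H →L[ℂ] H) →CP (H →L[ℂ] H))
    (p q : ℝ≥0∞) (Y : H →L[ℂ] H) : ℝ :=
  sSup {c : ℝ | ∃ A ∈ N, ∃ B ∈ N, A ≠ 0 ∧ B ≠ 0 ∧
    c = wNorm (sigmaTr E) q (A * Y * B) /
      (wNorm (sigmaTr E) (2 * (q⁻¹ - p⁻¹)⁻¹) A * wNorm (sigmaTr E) (2 * (q⁻¹ - p⁻¹)⁻¹) B)}

/-- The uniform convexity inequality in `L_2(N, L_p(σ_Tr))`, `1 ≤ p ≤ 2`. -/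
def UniformConvexity (N : StarSubalgebra ℂ (H →L[ℂ] H)) (E : (H →L[ℂ] H) →CP (H →L[ℂ] H))
    (p : ℝ) : Prop :=
  ∀ X : H →L[ℂ] H, 0 ≤ X →
    (p - 1) * amalgNorm N E 2 (ENNReal.ofReal p) (X - E X) ^ 2 +
        amalgNorm N E 2 (ENNReal.ofReal p) (E X) ^ 2 ≤
      amalgNorm N E 2 (ENNReal.ofReal p) X ^ 2


end AmalgamatedLp

end

/-! Write σ for σ_Tr, which is invertible and commutes with N. Since N ≠ ⊥ there is a minimal
projection P of N other than 0 and 1 (`exists_minimal_proj`); since N ≠ ⊤ there is a nonzero Z = P Z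
(1 - P) with E Z = 0 (`IsCondExp.exists_offdiag`). The counterexample is X = W* W with W = P + ε Z
and ε small. Put s = Tr σP, and let r' be the exponent conjugate to r.

Testing with A = B = P gives ‖E X‖² ≥ s, and testing with A = P, B = 1 - P gives ‖X - E X‖ ≥ κ₀ ε
with κ₀ > 0. Uniform convexity would therefore force ‖X‖² ≥ s + (p - 1) κ₀² ε². In fact ‖X‖² ≤ s +
O(ε^(2r')), and r' > 1 because p < 2 makes r finite; as ε → 0 this is a contradiction
(`not_forall_quadratic_le_superquadratic`).

For the upper bound, Cauchy–Schwarz (`schatten_star_mul_le`) leaves only the p-norm of T = W σ^(1/p)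
A*A W*. This T lives under P, so a weighted Hölder inequality (`schatten_le_weighted_two`) replaces
its p-norm by the Hilbert–Schmidt norm of σ^(-1/r) T, which can be expanded in ε. Minimality gives P
A*A P = b P, and E Z = 0 makes the first-order term orthogonal to the leading one, so the norm is at
most √s (b + C ε² β) with β = ‖(1 - P) A*A (1 - P)‖ (`exists_weighted_two_le`). Hölder with
exponents r and r' (`re_tr_compression_le`) bounds this combination by ‖A‖_{2r}², and there the
small coefficient ε² enters only through its power r'. -/

noncomputable section

namespace AmalgamatedLp

variable {H : Type*} [NormedAddCommGroup H] [InnerProductSpace ℂ H]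
  [FiniteDimensional ℂ H] [CompleteSpace H]

/-! ### Trace, Hilbert–Schmidt form and operator norm -/

theorem tr_mul_comm (A B : H →L[ℂ] H) : tr (A * B) = tr (B * A) :=
  LinearMap.trace_mul_comm ℂ (A : H →ₗ[ℂ] H) (B : H →ₗ[ℂ] H)

theorem tr_eq_sum_inner {ι : Type*} [Fintype ι] (b : OrthonormalBasis ι ℂ H) (A : H →L[ℂ] H) :
    tr A = ∑ i, inner ℂ (b i) (A (b i)) :=
  LinearMap.trace_eq_sum_inner _ b

theorem tr_star (A : H →L[ℂ] H) : tr (star A) = star (tr A) := by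
  simp only [tr_eq_sum_inner (stdOrthonormalBasis ℂ H), star_sum]
  refine Finset.sum_congr rfl fun i _ => ?_
  rw [ContinuousLinearMap.star_eq_adjoint, ContinuousLinearMap.adjoint_inner_right]
  exact (inner_conj_symm _ _).symm

theorem re_tr_star (A : H →L[ℂ] H) : (tr (star A)).re = (tr A).re := by
  rw [tr_star]; rfl

theorem re_tr_nonneg {A : H →L[ℂ] H} (hA : 0 ≤ A) : 0 ≤ (tr A).re := by
  rw [tr_eq_sum_inner (stdOrthonormalBasis ℂ H), Complex.re_sum]
  rw [ContinuousLinearMap.nonneg_iff_isPositive] at hA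
  exact Finset.sum_nonneg fun i _ => hA.re_inner_nonneg_right _

theorem tr_star_mul_eq_sum {ι : Type*} [Fintype ι] (b : OrthonormalBasis ι ℂ H)
    (A B : H →L[ℂ] H) : tr (star A * B) = ∑ i, inner ℂ (A (b i)) (B (b i)) := by
  rw [tr_eq_sum_inner b]
  refine Finset.sum_congr rfl fun i _ => ?_
  rw [mul_apply_eq_comp, ContinuousLinearMap.star_eq_adjoint,
    ContinuousLinearMap.adjoint_inner_right]

theorem re_tr_star_mul_self {ι : Type*} [Fintype ι] (b : OrthonormalBasis ι ℂ H)
    (A : H →L[ℂ] H) : (tr (star A * A)).re = ∑ i, ‖A (b i)‖ ^ 2 := by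
  rw [tr_star_mul_eq_sum b, Complex.re_sum]
  exact Finset.sum_congr rfl fun i _ => inner_self_eq_norm_sq (𝕜 := ℂ) _

theorem re_tr_star_mul_le (A B : H →L[ℂ] H) :
    (tr (star A * B)).re ≤ √(tr (star A * A)).re * √(tr (star B * B)).re := by
  let b := stdOrthonormalBasis ℂ H
  rw [tr_star_mul_eq_sum b, Complex.re_sum, re_tr_star_mul_self b, re_tr_star_mul_self b]
  calc _ ≤ ∑ i, ‖A (b i)‖ * ‖B (b i)‖ :=
        Finset.sum_le_sum fun i _ => re_inner_le_norm (𝕜 := ℂ) _ _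
    _ ≤ _ := Real.sum_mul_le_sqrt_mul_sqrt _ _ _

theorem re_tr_le (A : H →L[ℂ] H) : (tr A).re ≤ Module.finrank ℂ H * ‖A‖ := by
  let b := stdOrthonormalBasis ℂ H
  rw [tr_eq_sum_inner b, Complex.re_sum]
  calc _ ≤ ∑ _i : Fin (Module.finrank ℂ H), ‖A‖ := Finset.sum_le_sum fun i _ => by
        refine (re_inner_le_norm (𝕜 := ℂ) _ _).trans ?_
        have := A.le_opNorm (b i)
        simpa using this
    _ = _ := by simp

theorem eq_zero_of_re_tr_star_mul_self {A : H →L[ℂ] H} (h : (tr (star A * A)).re = 0) :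
    A = 0 := by
  let b := stdOrthonormalBasis ℂ H
  rw [re_tr_star_mul_self b, Finset.sum_eq_zero_iff_of_nonneg fun i _ => by positivity] at h
  have h1 : (A : H →ₗ[ℂ] H) = 0 := b.toBasis.ext fun i => by
    simpa using h i (Finset.mem_univ i)
  ext x
  exact congrArg (fun f : H →ₗ[ℂ] H => f x) h1

theorem eq_zero_of_re_tr_eq_zero {A : H →L[ℂ] H} (hA : 0 ≤ A) (h : (tr A).re = 0) : A = 0 := by
  have h1 : CFC.sqrt A = 0 := by
    apply eq_zero_of_re_tr_star_mul_self
    rw [(CFC.sqrt_nonneg A).isSelfAdjoint.star_eq, CFC.sqrt_mul_sqrt_self A, h]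
  rw [← CFC.sqrt_mul_sqrt_self A, h1, mul_zero]

theorem re_tr_pos {A : H →L[ℂ] H} (hA : 0 ≤ A) (h : A ≠ 0) : 0 < (tr A).re :=
  (re_tr_nonneg hA).lt_of_ne fun h0 => h (eq_zero_of_re_tr_eq_zero hA h0.symm)

theorem norm_sq_le_re_tr (A : H →L[ℂ] H) : ‖A‖ ^ 2 ≤ (tr (star A * A)).re := by
  let b := stdOrthonormalBasis ℂ H
  have h : ‖A‖ ≤ √(tr (star A * A)).re := by
    refine A.opNorm_le_bound (Real.sqrt_nonneg _) fun x => ?_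
    rw [re_tr_star_mul_self b]
    calc ‖A x‖ = ‖∑ i, inner ℂ (b i) x • A (b i)‖ := by
          conv_lhs => rw [← b.sum_repr' x, map_sum]
          simp only [map_smul]
      _ ≤ ∑ i, ‖A (b i)‖ * ‖inner ℂ (b i) x‖ := by
          refine (norm_sum_le _ _).trans_eq (Finset.sum_congr rfl fun i _ => ?_)
          rw [norm_smul, mul_comm]
      _ ≤ √(∑ i, ‖A (b i)‖ ^ 2) * √(∑ i, ‖inner ℂ (b i) x‖ ^ 2) :=
          Real.sum_mul_le_sqrt_mul_sqrt _ _ _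
      _ = _ := by rw [b.sum_sq_norm_inner_right, Real.sqrt_sq (norm_nonneg _)]
  calc ‖A‖ ^ 2 ≤ (√(tr (star A * A)).re) ^ 2 := by gcongr
    _ = _ := Real.sq_sqrt (re_tr_nonneg (star_mul_self_nonneg A))

theorem norm_le_re_tr {A : H →L[ℂ] H} (hA : 0 ≤ A) : ‖A‖ ≤ (tr A).re := by
  have h := norm_sq_le_re_tr (CFC.sqrt A)
  have hs : star (CFC.sqrt A) = CFC.sqrt A := (CFC.sqrt_nonneg A).isSelfAdjoint.star_eq
  have h2 : ‖CFC.sqrt A‖ ^ 2 = ‖A‖ := by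
    rw [sq, ← CStarRing.norm_star_mul_self, hs, CFC.sqrt_mul_sqrt_self A]
  rwa [h2, hs, CFC.sqrt_mul_sqrt_self A] at h



/-! ### Functional calculus through interpolation on finite spectra -/

theorem finite_spectrum_real (a : H →L[ℂ] H) : (spectrum ℝ a).Finite := by
  nontriviality (H →L[ℂ] H)
  have : FiniteDimensional ℝ (H →L[ℂ] H) := FiniteDimensional.complexToReal _
  have hint : IsIntegral ℝ a := Algebra.IsIntegral.isIntegral a
  refine ((minpoly ℝ a).rootSet_finite ℝ).subset fun x hx => ?_
  have h := spectrum.subset_polynomial_aeval a (minpoly ℝ a) ⟨x, hx, rfl⟩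
  rw [minpoly.aeval, spectrum.zero_eq] at h
  rw [Polynomial.mem_rootSet_of_ne (minpoly.ne_zero hint)]
  simpa using h

/-- The polynomial depends only on `f` and `s`, so one polynomial serves several operators at once.
Identities between functions of different operators thereby become identities between powers. -/
theorem exists_polynomial_cfc (f : ℝ → ℝ) (s : Set ℝ) (hs : s.Finite) :
    ∃ q : Polynomial ℝ, (∀ x ∈ s, q.eval x = f x) ∧ ∀ a : H →L[ℂ] H, IsSelfAdjoint a →
      spectrum ℝ a ⊆ s → cfc f a = Polynomial.aeval a q := by
  classical
  refine ⟨Lagrange.interpolate hs.toFinset id f, ?_, ?_⟩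
  · intro x hx
    exact Lagrange.eval_interpolate_at_node f (Function.injective_id.injOn) (hs.mem_toFinset.2 hx)
  · intro a ha hsp
    rw [← cfc_polynomial _ a ha]
    refine cfc_congr fun x hx => ?_
    exact (Lagrange.eval_interpolate_at_node f (Function.injective_id.injOn)
      (hs.mem_toFinset.2 (hsp hx))).symm

theorem continuousOn_spectrum (f : ℝ → ℝ) (a : H →L[ℂ] H) : ContinuousOn f (spectrum ℝ a) :=
  (finite_spectrum_real a).continuousOn f

theorem aeval_mul_of_mul_eq {a a' P : H →L[ℂ] H} (h : a * P = a' * P) (hP : Commute a' P)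
    (q : Polynomial ℝ) : Polynomial.aeval a q * P = Polynomial.aeval a' q * P := by
  have hn : ∀ n : ℕ, a ^ n * P = a' ^ n * P := by
    intro n
    induction n with
    | zero => simp
    | succ n ih => rw [pow_succ, mul_assoc, h, hP.eq, ← mul_assoc, ih, mul_assoc, ← hP.eq,
        ← mul_assoc, ← pow_succ]
  induction q using Polynomial.induction_on' with
  | add p q hp hq => simp only [map_add, add_mul, hp, hq]
  | monomial n c => simp only [Polynomial.aeval_monomial, mul_assoc, hn]

theorem cfc_mul_of_mul_eq {a a' P : H →L[ℂ] H} (ha : IsSelfAdjoint a) (ha' : IsSelfAdjoint a')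
    (h : a * P = a' * P) (hP : Commute a' P) (f : ℝ → ℝ) : cfc f a * P = cfc f a' * P := by
  obtain ⟨q, -, hq⟩ := exists_polynomial_cfc (H := H) f (spectrum ℝ a ∪ spectrum ℝ a')
    ((finite_spectrum_real a).union (finite_spectrum_real a'))
  rw [hq a ha Set.subset_union_left, hq a' ha' Set.subset_union_right,
    aeval_mul_of_mul_eq h hP]

theorem mul_aeval_star_mul_self (K : H →L[ℂ] H) (q : Polynomial ℝ) :
    K * Polynomial.aeval (star K * K) q = Polynomial.aeval (K * star K) q * K := by
  have hn : ∀ n : ℕ, K * (star K * K) ^ n = (K * star K) ^ n * K := by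
    intro n
    induction n with
    | zero => simp
    | succ n ih => rw [pow_succ, ← mul_assoc, ih, pow_succ]; simp only [mul_assoc]
  induction q using Polynomial.induction_on' with
  | add p q hp hq => simp only [map_add, add_mul, mul_add, hp, hq]
  | monomial n c =>
    simp only [Polynomial.aeval_monomial, ← Algebra.smul_def, mul_smul_comm, smul_mul_assoc, hn]

/-- As `f 0 = 0`, the common interpolating polynomial is X g(X). The claim then follows from K
g(K*K) = g(KK*) K and cyclicity of the trace. -/
theorem tr_cfc_star_mul_self (K : H →L[ℂ] H) (f : ℝ → ℝ) (hf : f 0 = 0) :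
    tr (cfc f (star K * K)) = tr (cfc f (K * star K)) := by
  obtain ⟨q, hq0, hq⟩ := exists_polynomial_cfc (H := H) f
    (insert 0 (spectrum ℝ (star K * K) ∪ spectrum ℝ (K * star K)))
    (((finite_spectrum_real _).union (finite_spectrum_real _)).insert 0)
  rw [hq _ (.star_mul_self K) (Set.subset_union_left.trans (Set.subset_insert _ _)),
    hq _ (.mul_star_self K) (Set.subset_union_right.trans (Set.subset_insert _ _))]
  have h0 : q.IsRoot 0 := (hq0 0 (Set.mem_insert _ _)).trans hf
  obtain ⟨g, rfl⟩ := Polynomial.dvd_iff_isRoot.2 h0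
  simp only [map_zero, sub_zero, map_mul, Polynomial.aeval_X]
  rw [mul_assoc, mul_aeval_star_mul_self, tr_mul_comm, mul_assoc, tr_mul_comm]

theorem exists_eigenbasis {a : H →L[ℂ] H} (ha : IsSelfAdjoint a) :
    ∃ (b : OrthonormalBasis (Fin (Module.finrank ℂ H)) ℂ H) (l : Fin (Module.finrank ℂ H) → ℝ),
      (∀ i, l i ∈ spectrum ℝ a) ∧ ∀ f : ℝ → ℝ, ∀ i, cfc f a (b i) = (f (l i) : ℂ) • b i := by
  have hs : (a : H →ₗ[ℂ] H).IsSymmetric := ContinuousLinearMap.isSelfAdjoint_iff_isSymmetric.1 ha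
  have hap : ∀ i, a (hs.eigenvectorBasis rfl i) =
      (hs.eigenvalues rfl i : ℂ) • hs.eigenvectorBasis rfl i :=
    fun i => hs.apply_eigenvectorBasis rfl i
  have hpoly : ∀ (q : Polynomial ℝ) i, Polynomial.aeval a q (hs.eigenvectorBasis rfl i) =
      ((q.eval (hs.eigenvalues rfl i) : ℝ) : ℂ) • hs.eigenvectorBasis rfl i := by
    intro q i
    have hn : ∀ n : ℕ, (a ^ n) (hs.eigenvectorBasis rfl i) =
        ((hs.eigenvalues rfl i : ℂ) ^ n) • hs.eigenvectorBasis rfl i := by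
      intro n
      induction n with
      | zero => simp
      | succ n ih =>
        rw [pow_succ, mul_apply_eq_comp, hap, map_smul, ih, smul_smul, pow_succ']
    induction q using Polynomial.induction_on' with
    | add p q hp hq => simp [hp, hq, add_smul]
    | monomial n c =>
      rw [Polynomial.aeval_monomial, ← Algebra.smul_def, smul_apply, hn,
        ← Complex.coe_smul, smul_smul]
      simp
  have hmem : ∀ i, hs.eigenvalues rfl i ∈ spectrum ℝ a := by
    intro i hu
    rw [spectrum.mem_resolventSet_iff] at hu
    obtain ⟨u, hu⟩ := hu
    have h1 : (u : H →L[ℂ] H) (hs.eigenvectorBasis rfl i) = 0 := by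
      rw [hu, sub_apply, hap, Algebra.algebraMap_eq_smul_one, smul_apply, ← Complex.coe_smul]
      simp
    have h2 : hs.eigenvectorBasis rfl i = 0 := by
      have := congrArg (fun x => (↑u⁻¹ : H →L[ℂ] H) x) h1
      simpa only [← mul_apply_eq_comp, Units.inv_mul, one_apply_eq_self, map_zero] using this
    exact (hs.eigenvectorBasis rfl).orthonormal.ne_zero i h2
  refine ⟨hs.eigenvectorBasis rfl, hs.eigenvalues rfl, hmem, fun f i => ?_⟩
  obtain ⟨q, hq0, hq⟩ := exists_polynomial_cfc (H := H) f _ (finite_spectrum_real a)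
  rw [hq a ha subset_rfl, hpoly, hq0 _ (hmem i)]

/-- The weights are the squared overlaps of two eigenbases. They do not depend on `f` and `g`, which
reduces trace inequalities for non-commuting operators to scalar ones. -/
theorem re_tr_cfc_mul_cfc {a c : H →L[ℂ] H} (ha : IsSelfAdjoint a) (hc : IsSelfAdjoint c) :
    ∃ (l m : Fin (Module.finrank ℂ H) → ℝ)
      (w : Fin (Module.finrank ℂ H) → Fin (Module.finrank ℂ H) → ℝ),
      (∀ i, l i ∈ spectrum ℝ a) ∧ (∀ j, m j ∈ spectrum ℝ c) ∧ (∀ i j, 0 ≤ w i j) ∧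
      ∀ f g : ℝ → ℝ, (tr (cfc f a * cfc g c)).re = ∑ i, ∑ j, f (l i) * g (m j) * w i j := by
  obtain ⟨b, l, hl, hb⟩ := exists_eigenbasis ha
  obtain ⟨d, m, hm, hd⟩ := exists_eigenbasis hc
  refine ⟨l, m, fun i j => ‖inner ℂ (b i) (d j)‖ ^ 2, hl, hm, fun i j => by positivity, ?_⟩
  intro f g
  have hsa : ∀ x y, inner ℂ x (cfc f a y) = inner ℂ (cfc f a x) y := fun x y => by
    rw [← ContinuousLinearMap.adjoint_inner_left, ← ContinuousLinearMap.star_eq_adjoint,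
      (IsSelfAdjoint.cfc (f := f) (a := a)).star_eq]
  have h1 : ∀ j, (inner ℂ (d j) ((cfc f a * cfc g c) (d j))).re =
      ∑ i, f (l i) * g (m j) * ‖inner ℂ (b i) (d j)‖ ^ 2 := by
    intro j
    rw [mul_apply_eq_comp, hd, map_smul, inner_smul_right, ← b.sum_inner_mul_inner,
      Finset.mul_sum, Complex.re_sum]
    refine Finset.sum_congr rfl fun i _ => ?_
    rw [hsa, hb, inner_smul_left, ← inner_conj_symm (d j) (b i)]
    have h2 : (starRingEnd ℂ) (inner ℂ (b i) (d j)) * inner ℂ (b i) (d j) =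
        ((‖inner ℂ (b i) (d j)‖ ^ 2 : ℝ) : ℂ) := by
      rw [RCLike.conj_mul]; norm_cast
    rw [Complex.conj_ofReal]
    calc ((g (m j) : ℂ) * ((starRingEnd ℂ) (inner ℂ (b i) (d j)) *
          ((f (l i) : ℂ) * inner ℂ (b i) (d j)))).re
        = (((f (l i) * g (m j) : ℝ) : ℂ) * ((starRingEnd ℂ) (inner ℂ (b i) (d j)) *
          inner ℂ (b i) (d j))).re := by congr 1; push_cast; ring
      _ = _ := by rw [h2, ← Complex.ofReal_mul, Complex.ofReal_re]
  rw [tr_eq_sum_inner d, Complex.re_sum, Finset.sum_comm]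
  exact Finset.sum_congr rfl fun j _ => h1 j

/-- The scalar inequality is summed against the nonnegative overlap weights; taking one of the two
functions equal to 1 recovers the single traces on the right. -/
theorem re_tr_cfc_mul_cfc_le {a c : H →L[ℂ] H} (ha : IsSelfAdjoint a) (hc : IsSelfAdjoint c)
    {f g h k : ℝ → ℝ} (hle : ∀ x ∈ spectrum ℝ a, ∀ y ∈ spectrum ℝ c, f x * g y ≤ h x + k y) :
    (tr (cfc f a * cfc g c)).re ≤ (tr (cfc h a)).re + (tr (cfc k c)).re := by
  obtain ⟨l, m, w, hl, hm, hw, hsum⟩ := re_tr_cfc_mul_cfc ha hc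
  have h1 := hsum h (fun _ => 1)
  have h2 := hsum (fun _ => 1) k
  rw [cfc_const_one ℝ c, mul_one] at h1
  rw [cfc_const_one ℝ a, one_mul] at h2
  rw [hsum f g, h1, h2, ← Finset.sum_add_distrib]
  refine Finset.sum_le_sum fun i _ => ?_
  rw [← Finset.sum_add_distrib]
  refine Finset.sum_le_sum fun j _ => ?_
  rw [← add_mul]
  have := hle _ (hl i) _ (hm j)
  exact mul_le_mul_of_nonneg_right (by linarith) (hw i j)

/-! ### Real powers and Hölder inequalities for Schatten norms -/

theorem rpow_zero_of_pos {x : ℝ} (hx : 0 < x) : (0 : H →L[ℂ] H) ^ x = 0 :=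
  CFC.zero_rpow hx.ne'

/-- Hölder's inequality for the trace. -/
theorem re_tr_rpow_mul_rpow_le {R G : H →L[ℂ] H} (hR : 0 ≤ R) (hG : 0 ≤ G) {a b : ℝ}
    (ha : 0 < a) (hb : 0 < b) (hab : a + b = 1) :
    (tr (R ^ a * G ^ b)).re ≤ (tr R).re ^ a * (tr G).re ^ b := by
  by_cases hR0 : R = 0
  · subst hR0; simp [rpow_zero_of_pos ha, Real.zero_rpow ha.ne']
  by_cases hG0 : G = 0
  · subst hG0; simp [rpow_zero_of_pos hb, Real.zero_rpow hb.ne']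
  have hx := re_tr_pos hR hR0
  have hy := re_tr_pos hG hG0
  set x := (tr R).re
  set y := (tr G).re
  -- Young's inequality for s/x and t/y, normalised by the two traces, so that the bound on the
  -- right sums to x^a y^b.
  have key := re_tr_cfc_mul_cfc_le (f := fun t => t ^ a) (g := fun t => t ^ b)
    (h := fun t => (x ^ a * y ^ b * a / x) * t) (k := fun t => (x ^ a * y ^ b * b / y) * t)
    hR.isSelfAdjoint hG.isSelfAdjoint (by
      intro s hs t ht
      have hs0 : 0 ≤ s := spectrum_nonneg_of_nonneg hR hs
      have ht0 : 0 ≤ t := spectrum_nonneg_of_nonneg hG ht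
      have hyoung := Real.geom_mean_le_arith_mean2_weighted ha.le hb.le
        (div_nonneg hs0 hx.le) (div_nonneg ht0 hy.le) hab
      rw [Real.div_rpow hs0 hx.le, Real.div_rpow ht0 hy.le] at hyoung
      have hxa : 0 < x ^ a := Real.rpow_pos_of_pos hx a
      have hyb : 0 < y ^ b := Real.rpow_pos_of_pos hy b
      calc s ^ a * t ^ b = x ^ a * y ^ b * (s ^ a / x ^ a * (t ^ b / y ^ b)) := by
            field_simp
        _ ≤ x ^ a * y ^ b * (a * (s / x) + b * (t / y)) := by gcongr
        _ = _ := by ring)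
  rw [cfc_const_mul_id _ R, cfc_const_mul_id _ G, ← Complex.coe_smul,
    ← Complex.coe_smul, map_smul, map_smul, smul_eq_mul, smul_eq_mul, Complex.re_ofReal_mul,
    Complex.re_ofReal_mul] at key
  rw [CFC.rpow_eq_cfc_real hR, CFC.rpow_eq_cfc_real hG]
  refine key.trans_eq ?_
  change x ^ a * y ^ b * a / x * x + x ^ a * y ^ b * b / y * y = x ^ a * y ^ b
  field_simp
  linear_combination hab

theorem op_rpow_nonneg (A : H →L[ℂ] H) (x : ℝ) : 0 ≤ A ^ x :=
  CFC.rpow_nonneg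

theorem re_tr_rpow_nonneg (A : H →L[ℂ] H) (x : ℝ) : 0 ≤ (tr (A ^ x)).re :=
  re_tr_nonneg (op_rpow_nonneg A x)

theorem rpow_mul_rpow {A : H →L[ℂ] H} (hA : 0 ≤ A) {x y : ℝ} (hx : 0 < x) (hy : 0 < y) :
    A ^ x * A ^ y = A ^ (x + y) := by
  rw [CFC.rpow_eq_cfc_real hA, CFC.rpow_eq_cfc_real hA, CFC.rpow_eq_cfc_real hA,
    ← cfc_mul _ _ A (continuousOn_spectrum _ _) (continuousOn_spectrum _ _)]
  refine cfc_congr fun t ht => ?_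
  exact (Real.rpow_add_of_nonneg (spectrum_nonneg_of_nonneg hA ht) hx.le hy.le).symm

theorem rpow_rpow_one_div {A : H →L[ℂ] H} (hA : 0 ≤ A) {x : ℝ} (hx : 0 < x) :
    (A ^ x) ^ (1 / x) = A := by
  rw [CFC.rpow_rpow_of_exponent_nonneg A x (1 / x) hx.le (by positivity) hA,
    mul_one_div_cancel hx.ne', CFC.rpow_one A hA]

theorem rpow_isSelfAdjoint (A : H →L[ℂ] H) (x : ℝ) : IsSelfAdjoint (A ^ x) :=
  (op_rpow_nonneg A x).isSelfAdjoint

theorem commute_rpow {A B : H →L[ℂ] H} (h : Commute A B) (x : ℝ) : Commute (A ^ x) B := by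
  rw [CFC.rpow_def]
  exact h.cfc_nnreal _

theorem abs_rpow (K : H →L[ℂ] H) {p : ℝ} (hp : 0 ≤ p) :
    CFC.abs K ^ p = (star K * K) ^ (p / 2) := by
  rw [CFC.abs, CFC.sqrt_eq_rpow, CFC.rpow_rpow_of_exponent_nonneg _ _ _ (by norm_num) hp
    (star_mul_self_nonneg K)]
  congr 1; ring

theorem re_tr_rpow_star_mul_self (K : H →L[ℂ] H) {x : ℝ} (hx : 0 < x) :
    (tr ((star K * K) ^ x)).re = (tr ((K * star K) ^ x)).re := by
  rw [CFC.rpow_eq_cfc_real (star_mul_self_nonneg K), CFC.rpow_eq_cfc_real (mul_star_self_nonneg K),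
    tr_cfc_star_mul_self K (fun t => t ^ x) (Real.zero_rpow hx.ne')]

theorem rpow_mul_of_mul_eq {A A' P : H →L[ℂ] H} (hA : 0 ≤ A) (hA' : 0 ≤ A')
    (h : A * P = A' * P) (hP : Commute A' P) (x : ℝ) : A ^ x * P = A' ^ x * P := by
  rw [CFC.rpow_eq_cfc_real hA, CFC.rpow_eq_cfc_real hA']
  exact cfc_mul_of_mul_eq hA.isSelfAdjoint hA'.isSelfAdjoint h hP _

theorem mul_nonneg_of_commute_proj {A P : H →L[ℂ] H} (hA : 0 ≤ A) (hP : IsStarProjection P)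
    (h : Commute A P) : 0 ≤ A * P := by
  have h1 := star_left_conjugate_nonneg hA P
  rwa [hP.isSelfAdjoint.star_eq, ← h.eq, mul_assoc, hP.isIdempotentElem.eq] at h1

theorem smul_rpow {A : H →L[ℂ] H} (hA : 0 ≤ A) {c : ℝ} (hc : 0 ≤ c) (x : ℝ) :
    (c • A) ^ x = (c ^ x) • A ^ x := by
  rw [CFC.rpow_eq_cfc_real (smul_nonneg hc hA), CFC.rpow_eq_cfc_real hA,
    ← cfc_smul _ _ _ (continuousOn_spectrum _ _)]
  have := cfc_comp_const_mul c (fun t : ℝ => t ^ x) A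
    (((finite_spectrum_real A).image _).continuousOn _) hA.isSelfAdjoint
  rw [← this]
  refine cfc_congr fun t ht => ?_
  simp [Real.mul_rpow hc (spectrum_nonneg_of_nonneg hA ht)]

/-- The operator agrees with A on the range of P and with cA on the range of Q, so its power can be
computed on each block separately. -/
theorem add_smul_proj_rpow {A P Q : H →L[ℂ] H} (hA : 0 ≤ A) (hP : IsStarProjection P)
    (hQ : IsStarProjection Q) (hPQ : P + Q = 1) (hPQ0 : P * Q = 0) (hQP0 : Q * P = 0)
    (hAP : Commute A P) (hAQ : Commute A Q) {c : ℝ} (hc : 0 ≤ c) (x : ℝ) :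
    (A * P + c • (A * Q)) ^ x = A ^ x * P + (c ^ x) • (A ^ x * Q) := by
  have h0 : 0 ≤ A * P + c • (A * Q) := add_nonneg (mul_nonneg_of_commute_proj hA hP hAP)
    (smul_nonneg hc (mul_nonneg_of_commute_proj hA hQ hAQ))
  have h1 : (A * P + c • (A * Q)) ^ x * P = A ^ x * P := by
    refine rpow_mul_of_mul_eq h0 hA ?_ hAP x
    rw [add_mul, mul_assoc, hP.isIdempotentElem.eq, smul_mul_assoc, mul_assoc, hQP0]
    simp
  have h2 : (A * P + c • (A * Q)) ^ x * Q = (c • A) ^ x * Q := by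
    refine rpow_mul_of_mul_eq h0 (smul_nonneg hc hA) ?_ (hAQ.smul_left c) x
    rw [add_mul, mul_assoc, hPQ0, smul_mul_assoc, mul_assoc, hQ.isIdempotentElem.eq]
    simp
  rw [← mul_one ((A * P + c • (A * Q)) ^ x), ← hPQ, mul_add, h1, h2, smul_rpow hA hc,
    smul_mul_assoc]

theorem mul_proj_rpow {A P : H →L[ℂ] H} (hA : 0 ≤ A) (hP : IsStarProjection P)
    (hAP : Commute A P) {x : ℝ} (hx : 0 < x) : (A * P) ^ x = A ^ x * P := by
  have := add_smul_proj_rpow hA hP hP.one_sub (by abel)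
    (by rw [mul_sub, hP.isIdempotentElem.eq]; simp) (by rw [sub_mul, hP.isIdempotentElem.eq]; simp)
    hAP ((Commute.one_right A).sub_right hAP) le_rfl x
  simpa [Real.zero_rpow hx.ne'] using this

theorem re_tr_mul_le_holder {R G : H →L[ℂ] H} (hR : 0 ≤ R) (hG : 0 ≤ G) {p q : ℝ}
    (hpq : p.HolderConjugate q) :
    (tr (R * G)).re ≤ (tr (R ^ p)).re ^ (1 / p) * (tr (G ^ q)).re ^ (1 / q) := by
  have h := re_tr_rpow_mul_rpow_le (op_rpow_nonneg R p)
    (op_rpow_nonneg G q) hpq.one_div_pos hpq.symm.one_div_pos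
    (by rw [hpq.one_div_add_one_div]; simp)
  rwa [rpow_rpow_one_div hR hpq.pos, rpow_rpow_one_div hG hpq.symm.pos] at h

theorem rpow_one_div_le_of_le_mul {t c p q : ℝ} (ht : 0 ≤ t) (hc : 0 ≤ c)
    (hpq : p.HolderConjugate q) (h : t ≤ c * t ^ (1 / q)) : t ^ (1 / p) ≤ c := by
  rcases ht.eq_or_lt with rfl | ht
  · rwa [Real.zero_rpow hpq.one_div_pos.ne']
  · have h1 : t = t ^ (1 / p) * t ^ (1 / q) := by
      rw [← Real.rpow_add ht, hpq.one_div_add_one_div]; simp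
    rw [h1] at h
    have h2 : 0 < t ^ (1 / q) := Real.rpow_pos_of_pos ht _
    have h3 : (t ^ (1 / p) * t ^ (1 / q)) ^ (1 / q) = t ^ (1 / q) := by rw [← h1]
    rw [h3] at h
    exact le_of_mul_le_mul_right h h2

/-- The outer exponents may be negative although A may be singular: the middle factor vanishes on
the kernel, so only the total exponent has to be positive. -/
theorem cfc_rpow_mul_mul_cfc_rpow {A : H →L[ℂ] H} (hA : 0 ≤ A) {x z : ℝ} (h : 0 < x + 1 + z) :
    cfc (fun t : ℝ => t ^ x) A * A * cfc (fun t : ℝ => t ^ z) A = A ^ (x + 1 + z) := by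
  have hcont := fun f : ℝ → ℝ => continuousOn_spectrum f A
  have hid : cfc (fun x : ℝ => x) A = A := cfc_id' ℝ A hA.isSelfAdjoint
  rw [CFC.rpow_eq_cfc_real hA]
  nth_rw 2 [← hid]
  rw [← cfc_mul _ _ A (hcont _) (hcont _), ← cfc_mul _ _ A (hcont _) (hcont _)]
  refine cfc_congr fun t ht => ?_
  have ht0 : 0 ≤ t := spectrum_nonneg_of_nonneg hA ht
  rcases ht0.eq_or_lt with rfl | ht0
  · simp [Real.zero_rpow h.ne']
  · change t ^ x * t * t ^ z = t ^ (x + 1 + z)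
    rw [Real.rpow_add ht0, Real.rpow_add ht0, Real.rpow_one]

theorem sqrt_mul_sqrt_le {x y m n s : ℝ} (hm : 0 ≤ m) (hn : 0 ≤ n) (hs : 0 ≤ s)
    (hx : x ≤ m * s) (hy : y ≤ n * s) : √x * √y ≤ √m * √n * s := by
  calc √x * √y ≤ √(m * s) * √(n * s) := by gcongr
    _ = √m * √n * (√s * √s) := by rw [Real.sqrt_mul hm, Real.sqrt_mul hn]; ring
    _ = _ := by rw [Real.mul_self_sqrt hs]

set_option maxHeartbeats 1000000 in
/-- The Cauchy–Schwarz inequality `‖M* N‖_p ≤ ‖M M*‖_p^{1/2} ‖N N*‖_p^{1/2}` for Schatten norms. -/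
theorem schatten_star_mul_le (M N : H →L[ℂ] H) {p : ℝ} (hp : 1 < p) :
    (tr (CFC.abs (star M * N) ^ p)).re ^ (1 / p) ≤
      √((tr ((M * star M) ^ p)).re ^ (1 / p)) * √((tr ((N * star N) ^ p)).re ^ (1 / p)) := by
  have hpq : p.HolderConjugate (p / (p - 1)) := Real.HolderConjugate.conjExponent hp
  set q := p / (p - 1) with hq
  have hp0 : 0 < p := by linarith
  have hp1 : 0 < p - 1 := by linarith
  set Y := star M * N with hY
  set A := star Y * Y with hA
  have hA0 : 0 ≤ A := star_mul_self_nonneg Y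
  have hcont := fun f : ℝ → ℝ => continuousOn_spectrum f A
  rw [abs_rpow Y hp0.le, ← hA]
  set t := (tr (A ^ (p / 2))).re
  have ht : 0 ≤ t := re_tr_rpow_nonneg _ _
  -- The exponents split A^(p/2) as d A e in such a way that d A d and e e are both A^((p-1)/2),
  -- whose q-th power is A^(p/2) again. Then t is the Hilbert–Schmidt pairing of M Y d and N e, and
  -- Hölder bounds each factor by a Schatten norm times t^(1/q).
  set d := cfc (fun x : ℝ => x ^ ((p - 3) / 4)) A with hd
  set e := cfc (fun x : ℝ => x ^ ((p - 1) / 4)) A with he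
  have hds : star d = d := (IsSelfAdjoint.cfc (f := _) (a := A)).star_eq
  have hes : star e = e := (IsSelfAdjoint.cfc (f := _) (a := A)).star_eq
  have hdAe : d * A * e = A ^ (p / 2) := by
    rw [hd, he, cfc_rpow_mul_mul_cfc_rpow hA0 (by linarith)]
    congr 1; ring
  have hdAd : d * A * d = A ^ ((p - 1) / 2) := by
    rw [hd, cfc_rpow_mul_mul_cfc_rpow hA0 (by linarith)]
    congr 1; ring
  have hee : e * e = A ^ ((p - 1) / 2) := by
    rw [CFC.rpow_eq_cfc_real hA0, he, ← cfc_mul _ _ A (hcont _) (hcont _)]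
    refine cfc_congr fun x hx => ?_
    have hx0 : 0 ≤ x := spectrum_nonneg_of_nonneg hA0 hx
    change x ^ ((p - 1) / 4) * x ^ ((p - 1) / 4) = x ^ ((p - 1) / 2)
    rw [← Real.rpow_add_of_nonneg hx0 (by linarith) (by linarith)]
    congr 1; ring
  have hAq : (A ^ ((p - 1) / 2)) ^ q = A ^ (p / 2) := by
    rw [CFC.rpow_rpow_of_exponent_nonneg A _ _ (by linarith) hpq.symm.pos.le hA0]
    congr 1; rw [hq]; field_simp
  have hN : (tr (star (N * e) * (N * e))).re ≤
      (tr ((N * star N) ^ p)).re ^ (1 / p) * t ^ (1 / q) := by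
    have h1 : tr (star (N * e) * (N * e)) = tr (star N * N * (A ^ ((p - 1) / 2))) := by
      rw [star_mul, hes, mul_assoc, tr_mul_comm, ← hee]; simp only [mul_assoc]
    rw [h1]
    refine (re_tr_mul_le_holder (star_mul_self_nonneg N) (op_rpow_nonneg _ _) hpq).trans_eq ?_
    rw [hAq, re_tr_rpow_star_mul_self N hp0]
  have hM : (tr (star (M * (Y * d)) * (M * (Y * d)))).re ≤
      (tr ((M * star M) ^ p)).re ^ (1 / p) * t ^ (1 / q) := by
    have h1 : tr (star (M * (Y * d)) * (M * (Y * d))) =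
        tr (star M * M * ((Y * d) * star (Y * d))) := by
      rw [star_mul M, mul_assoc, tr_mul_comm]; simp only [mul_assoc]
    rw [h1]
    refine (re_tr_mul_le_holder (star_mul_self_nonneg M) (mul_star_self_nonneg _) hpq).trans_eq ?_
    rw [← re_tr_rpow_star_mul_self (Y * d) hpq.symm.pos, ← re_tr_rpow_star_mul_self M hp0]
    have h2 : star (Y * d) * (Y * d) = A ^ ((p - 1) / 2) := by
      rw [← hdAd, star_mul, hds, hA]; simp only [mul_assoc]
    rw [h2, hAq]
  have hMN : t ≤ √((tr ((M * star M) ^ p)).re ^ (1 / p)) * √((tr ((N * star N) ^ p)).re ^ (1 / p))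
      * t ^ (1 / q) := by
    have h1 : A ^ (p / 2) = star (M * (Y * d)) * (N * e) := by
      rw [← hdAe, star_mul M, star_mul Y, hds]
      change d * (star Y * (star M * N)) * e = _
      simp only [mul_assoc]
    have h2 := re_tr_star_mul_le (M * (Y * d)) (N * e)
    rw [← h1] at h2
    refine h2.trans (sqrt_mul_sqrt_le ?_ ?_ ?_ hM hN)
    · exact Real.rpow_nonneg (re_tr_rpow_nonneg _ _) _
    · exact Real.rpow_nonneg (re_tr_rpow_nonneg _ _) _
    · exact Real.rpow_nonneg ht _
  exact rpow_one_div_le_of_le_mul ht (by positivity) hpq hMN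

/-- A weighted Hölder inequality comparing the Schatten `p`-norm, `1 < p < 2`, of a positive
operator supported under a projection with a weighted Hilbert–Schmidt norm. -/
theorem schatten_le_weighted_two {σ P T : H →L[ℂ] H} (hσ : IsStrictlyPositive σ)
    (hP : IsStarProjection P) (hσP : Commute σ P) (hT : 0 ≤ T) (hPT : P * T = T) {p r : ℝ}
    (hp : 1 < p) (hr : 0 < r) (hpr : 1 / r = 1 / p - 1 / 2) :
    (tr (T ^ p)).re ^ (1 / p) ≤ (tr (σ * P)).re ^ (1 / r) *
      √(tr (star (σ ^ (-(1 / r)) * T) * (σ ^ (-(1 / r)) * T))).re := by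
  have hpq : p.HolderConjugate (p / (p - 1)) := Real.HolderConjugate.conjExponent hp
  have hp0 : 0 < p := by linarith
  have hp1 : 0 < p - 1 := by linarith
  have ht : 0 ≤ (tr (T ^ p)).re := re_tr_rpow_nonneg _ _
  have hσP0 : 0 ≤ σ * P := mul_nonneg_of_commute_proj hσ.nonneg hP hσP
  refine rpow_one_div_le_of_le_mul ht
    (mul_nonneg (Real.rpow_nonneg (re_tr_nonneg hσP0) _) (Real.sqrt_nonneg _)) hpq ?_
  -- Inserting σ^(1/r) σ^(-1/r) between T^(p-1) P and T writes Tr T^p as a Hilbert–Schmidt pairing,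
  -- ready for Cauchy–Schwarz.
  have h1 : T ^ p = star (σ ^ (1 / r) * P * T ^ (p - 1)) * (σ ^ (-(1 / r)) * T) := by
    have h2 : T ^ p = T ^ (p - 1) * T := by
      have := rpow_mul_rpow hT hp1 one_pos
      rwa [CFC.rpow_one T hT, sub_add_cancel, eq_comm] at this
    rw [star_mul, star_mul, hP.isSelfAdjoint.star_eq, (rpow_isSelfAdjoint T _).star_eq,
      (rpow_isSelfAdjoint σ _).star_eq, h2]
    conv_lhs => rw [← hPT]
    rw [hPT]
    simp only [mul_assoc]
    rw [← mul_assoc (σ ^ (1 / r)) _ T, CFC.rpow_mul_rpow_neg (1 / r) hσ, one_mul, hPT]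
  have hc := re_tr_star_mul_le (σ ^ (1 / r) * P * T ^ (p - 1)) (σ ^ (-(1 / r)) * T)
  rw [← h1] at hc
  have hPr : Commute (σ ^ (1 / r)) P := commute_rpow hσP _
  -- Trace Hölder applies because 2/r and 2 - 2/p add up to 1, which is the relation between p and
  -- r.
  have h3 : (tr (star (σ ^ (1 / r) * P * T ^ (p - 1)) * (σ ^ (1 / r) * P * T ^ (p - 1)))).re ≤
      (tr (σ * P)).re ^ (2 / r) * (tr (T ^ p)).re ^ (2 - 2 / p) := by
    have h4 : tr (star (σ ^ (1 / r) * P * T ^ (p - 1)) * (σ ^ (1 / r) * P * T ^ (p - 1))) =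
        tr ((σ * P) ^ (2 / r) * (T ^ p) ^ (2 - 2 / p)) := by
      rw [CFC.rpow_rpow_of_exponent_nonneg T _ _ hp0.le
        (by rw [sub_nonneg, div_le_iff₀ hp0]; linarith) hT,
        show p * (2 - 2 / p) = (p - 1) + (p - 1) by field_simp; ring, ← rpow_mul_rpow hT hp1 hp1,
        show 2 / r = 1 / r + 1 / r by ring, ← rpow_mul_rpow hσP0 (by positivity) (by positivity),
        mul_proj_rpow hσ.nonneg hP hσP (by positivity), star_mul, (rpow_isSelfAdjoint T _).star_eq,
        star_mul, hP.isSelfAdjoint.star_eq, (rpow_isSelfAdjoint σ _).star_eq, mul_assoc,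
        tr_mul_comm, ← hPr.eq]
      simp only [mul_assoc]
    rw [h4]
    exact re_tr_rpow_mul_rpow_le hσP0 (op_rpow_nonneg _ _) (by positivity)
      (by rw [sub_pos, div_lt_iff₀ hp0]; linarith) (by
        have : 2 / r = 2 * (1 / r) := by ring
        rw [this, hpr]; ring)
  refine hc.trans ((mul_le_mul_of_nonneg_right (Real.sqrt_le_sqrt h3)
    (Real.sqrt_nonneg _)).trans_eq ?_)
  rw [Real.sqrt_mul (Real.rpow_nonneg (re_tr_nonneg hσP0) _), Real.sqrt_eq_rpow, Real.sqrt_eq_rpow,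
    ← Real.rpow_mul (re_tr_nonneg hσP0), ← Real.rpow_mul ht,
    show 2 / r * (1 / 2) = 1 / r by ring,
    show (2 - 2 / p) * (1 / 2) = 1 / (p / (p - 1)) by field_simp]
  ring

/-! ### The conditional expectation and its reference state -/

theorem eq_of_tr_mul_eq {A B : H →L[ℂ] H} (h : ∀ Y, tr (A * Y) = tr (B * Y)) : A = B := by
  ext x
  refine ext_inner_left ℂ fun y => ?_
  rw [← tr_mul_rankOne, ← tr_mul_rankOne, h]

theorem tr_sigmaTr_mul (E : (H →L[ℂ] H) →CP (H →L[ℂ] H)) (Y : H →L[ℂ] H) :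
    tr (sigmaTr E * Y) = (Module.finrank ℂ H : ℂ)⁻¹ * tr (E Y) := by
  rw [sigmaTr, tr_predual_mul, smul_mul_assoc, one_mul, map_smul, smul_eq_mul]

section CondExp

variable {N : StarSubalgebra ℂ (H →L[ℂ] H)} {E : (H →L[ℂ] H) →CP (H →L[ℂ] H)}

theorem IsCondExp.map_mul_left (hE : IsCondExp N E) {A : H →L[ℂ] H} (hA : A ∈ N)
    (X : H →L[ℂ] H) : E (A * X) = A * E X := by
  simpa using hE.bimodule A hA 1 (one_mem N) X

theorem IsCondExp.map_mul_right (hE : IsCondExp N E) {B : H →L[ℂ] H} (hB : B ∈ N)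
    (X : H →L[ℂ] H) : E (X * B) = E X * B := by
  simpa using hE.bimodule 1 (one_mem N) B hB X

theorem IsCondExp.map_of_mem (hE : IsCondExp N E) {A : H →L[ℂ] H} (hA : A ∈ N) : E A = A := by
  simpa [hE.unital] using hE.map_mul_left hA 1

/-- The functional Tr(σ ·) is the normalised trace composed with E, so for A in N the bimodule
property and cyclicity let A move from one side of σ to the other. All later rearrangements of
powers of σ rest on this. -/
theorem IsCondExp.commute_sigmaTr (hE : IsCondExp N E) {A : H →L[ℂ] H} (hA : A ∈ N) :
    Commute (sigmaTr E) A := by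
  refine eq_of_tr_mul_eq fun Y => ?_
  rw [mul_assoc, tr_sigmaTr_mul, mul_assoc, tr_mul_comm A, mul_assoc, tr_sigmaTr_mul,
    hE.map_mul_left hA, hE.map_mul_right hA, tr_mul_comm]

theorem inner_sigmaTr (E : (H →L[ℂ] H) →CP (H →L[ℂ] H)) (x : H) :
    inner ℂ x (sigmaTr E x) =
      (Module.finrank ℂ H : ℂ)⁻¹ * tr (E (InnerProductSpace.rankOne ℂ x x)) := by
  rw [← tr_mul_rankOne, tr_sigmaTr_mul]

theorem rankOne_self_nonneg (x : H) : 0 ≤ InnerProductSpace.rankOne ℂ x x :=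
  (ContinuousLinearMap.nonneg_iff_isPositive _).2 (InnerProductSpace.isPositive_rankOne_self x)

theorem tr_eq_re_of_nonneg {A : H →L[ℂ] H} (hA : 0 ≤ A) : tr A = ((tr A).re : ℂ) := by
  have h := tr_star A
  rw [hA.isSelfAdjoint.star_eq] at h
  exact (Complex.conj_eq_iff_re.1 h.symm).symm

theorem re_inner_sigmaTr (E : (H →L[ℂ] H) →CP (H →L[ℂ] H)) (x : H) :
    inner ℂ x (sigmaTr E x) =
      (((Module.finrank ℂ H : ℝ)⁻¹ * (tr (E (InnerProductSpace.rankOne ℂ x x))).re : ℝ) : ℂ) := by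
  rw [inner_sigmaTr, tr_eq_re_of_nonneg (map_nonneg E (rankOne_self_nonneg x))]
  push_cast
  rw [Complex.ofReal_re]

theorem sigmaTr_nonneg (E : (H →L[ℂ] H) →CP (H →L[ℂ] H)) : 0 ≤ sigmaTr E := by
  rw [ContinuousLinearMap.nonneg_iff_isPositive, ContinuousLinearMap.isPositive_iff_complex]
  intro x
  have h := re_inner_sigmaTr E x
  rw [← inner_conj_symm, h, Complex.conj_ofReal]
  exact ⟨rfl, by
    simpa using mul_nonneg (by positivity)
      (re_tr_nonneg (map_nonneg E (rankOne_self_nonneg x)))⟩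

/-- A kernel vector x of σ gives Tr E(|x⟩⟨x|) = 0, hence E(|x⟩⟨x|) = 0, and faithfulness forces x =
0. -/
theorem IsFaithful.sigmaTr_isStrictlyPositive (hEf : IsFaithful E) :
    IsStrictlyPositive (sigmaTr E) := by
  refine (IsStrictlyPositive.iff_of_unital).2 ⟨sigmaTr_nonneg E, ?_⟩
  rw [ContinuousLinearMap.isUnit_iff_bijective]
  have hinj : Function.Injective (sigmaTr E) := by
    refine (injective_iff_map_eq_zero _).2 fun x hx => ?_
    by_contra hx0
    have : Nontrivial H := ⟨x, 0, hx0⟩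
    have h := re_inner_sigmaTr E x
    rw [hx, inner_zero_right, ← Complex.ofReal_zero, Complex.ofReal_inj] at h
    have hd : (0 : ℝ) < (Module.finrank ℂ H : ℝ)⁻¹ :=
      inv_pos.2 (Nat.cast_pos.2 Module.finrank_pos)
    have hr : InnerProductSpace.rankOne ℂ x x ≠ 0 := fun h0 => by
      have := congrArg (fun A : H →L[ℂ] H => A x) h0
      simp [hx0] at this
    have hpos := re_tr_pos (map_nonneg E (rankOne_self_nonneg x))
      fun h0 => hr (hEf _ (rankOne_self_nonneg x) h0)
    exact (mul_pos hd hpos).ne h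
  exact ⟨hinj, LinearMap.injective_iff_surjective (f := (sigmaTr E : H →ₗ[ℂ] H)).1 hinj⟩

end CondExp

/-! ### Weighted Schatten norms -/

section WeightedNorm

theorem op_abs_nonneg (K : H →L[ℂ] H) : 0 ≤ CFC.abs K :=
  CFC.abs_nonneg K

theorem op_abs_of_nonneg {K : H →L[ℂ] H} (hK : 0 ≤ K) : CFC.abs K = K :=
  CFC.abs_of_nonneg K hK

theorem wNorm_ofReal (σ X : H →L[ℂ] H) {p : ℝ} (hp : 0 < p) :
    wNorm σ (ENNReal.ofReal p) X =
      (tr (CFC.abs (σ ^ (1 / (2 * p)) * X * σ ^ (1 / (2 * p))) ^ p)).re ^ (1 / p) := by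
  rw [wNorm, if_neg ENNReal.ofReal_ne_top, ENNReal.toReal_ofReal hp.le]

theorem norm_le_schatten (K : H →L[ℂ] H) {p : ℝ} (hp : 0 < p) :
    ‖K‖ ≤ (tr (CFC.abs K ^ p)).re ^ (1 / p) := by
  have h := norm_le_re_tr (op_rpow_nonneg (CFC.abs K) p)
  rw [CFC.norm_rpow _ hp, CFC.norm_abs] at h
  calc ‖K‖ = (‖K‖ ^ p) ^ (1 / p) := by
        rw [← Real.rpow_mul (norm_nonneg _), mul_one_div_cancel hp.ne', Real.rpow_one]
    _ ≤ _ := Real.rpow_le_rpow (by positivity) h (by positivity)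

theorem schatten_le_norm (K : H →L[ℂ] H) {p : ℝ} (hp : 0 < p) :
    (tr (CFC.abs K ^ p)).re ^ (1 / p) ≤ (Module.finrank ℂ H : ℝ) ^ (1 / p) * ‖K‖ := by
  have h := re_tr_le (CFC.abs K ^ p)
  rw [CFC.norm_rpow _ hp, CFC.norm_abs] at h
  calc _ ≤ ((Module.finrank ℂ H : ℝ) * ‖K‖ ^ p) ^ (1 / p) :=
        Real.rpow_le_rpow (re_tr_rpow_nonneg _ _) h (by positivity)
    _ = _ := by
        rw [Real.mul_rpow (by positivity) (by positivity), ← Real.rpow_mul (norm_nonneg _),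
          mul_one_div_cancel hp.ne', Real.rpow_one]

theorem wNorm_nonneg (σ X : H →L[ℂ] H) {p : ℝ} (hp : 0 < p) :
    0 ≤ wNorm σ (ENNReal.ofReal p) X := by
  rw [wNorm_ofReal σ X hp]
  exact Real.rpow_nonneg (re_tr_rpow_nonneg _ _) _

theorem exists_wNorm_le (σ : H →L[ℂ] H) {p : ℝ} (hp : 0 < p) :
    ∃ C, 0 ≤ C ∧ ∀ X, wNorm σ (ENNReal.ofReal p) X ≤ C * ‖X‖ := by
  refine ⟨(Module.finrank ℂ H : ℝ) ^ (1 / p) *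
    (‖σ ^ (1 / (2 * p))‖ * ‖σ ^ (1 / (2 * p))‖), by positivity, fun X => ?_⟩
  rw [wNorm_ofReal σ X hp, mul_assoc ((Module.finrank ℂ H : ℝ) ^ (1 / p))]
  have h : ‖σ ^ (1 / (2 * p)) * X * σ ^ (1 / (2 * p))‖ ≤
      ‖σ ^ (1 / (2 * p))‖ * ‖σ ^ (1 / (2 * p))‖ * ‖X‖ := norm_mul₃_le.trans_eq (by ring)
  exact (schatten_le_norm _ hp).trans (mul_le_mul_of_nonneg_left h (by positivity))

/-- Together with `exists_wNorm_le`, this makes the supremum in the amalgamated norm bounded; it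
also shows that the denominators there do not vanish. -/
theorem exists_norm_le_wNorm {σ : H →L[ℂ] H} (hσ : IsStrictlyPositive σ) {p : ℝ} (hp : 0 < p) :
    ∃ C, 0 ≤ C ∧ ∀ X, ‖X‖ ≤ C * wNorm σ (ENNReal.ofReal p) X := by
  set s := 1 / (2 * p)
  refine ⟨‖σ ^ (-s)‖ * ‖σ ^ (-s)‖, by positivity, fun X => ?_⟩
  rw [wNorm_ofReal σ X hp]
  have hX : X = σ ^ (-s) * (σ ^ s * X * σ ^ s) * σ ^ (-s) := by
    simp only [mul_assoc]
    rw [CFC.rpow_mul_rpow_neg s hσ, mul_one, ← mul_assoc, CFC.rpow_neg_mul_rpow s hσ, one_mul]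
  calc ‖X‖ = ‖σ ^ (-s) * (σ ^ s * X * σ ^ s) * σ ^ (-s)‖ := by rw [← hX]
    _ ≤ ‖σ ^ (-s)‖ * ‖σ ^ s * X * σ ^ s‖ * ‖σ ^ (-s)‖ := norm_mul₃_le
    _ = ‖σ ^ (-s)‖ * ‖σ ^ (-s)‖ * ‖σ ^ s * X * σ ^ s‖ := by ring
    _ ≤ _ := mul_le_mul_of_nonneg_left (norm_le_schatten _ hp) (by positivity)

theorem wNorm_pos {σ X : H →L[ℂ] H} (hσ : IsStrictlyPositive σ) {p : ℝ} (hp : 0 < p)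
    (hX : X ≠ 0) : 0 < wNorm σ (ENNReal.ofReal p) X := by
  obtain ⟨C, hC, h⟩ := exists_norm_le_wNorm hσ hp
  refine (wNorm_nonneg σ X hp).lt_of_ne fun h0 => ?_
  have h1 := h X
  rw [← h0, mul_zero] at h1
  exact hX (norm_le_zero_iff.1 h1)

theorem wNorm_real_smul (σ X : H →L[ℂ] H) {p : ℝ} (hp : 0 < p) {c : ℝ} (hc : 0 ≤ c) :
    wNorm σ (ENNReal.ofReal p) (c • X) = c * wNorm σ (ENNReal.ofReal p) X := by
  rw [wNorm_ofReal σ _ hp, wNorm_ofReal σ _ hp, mul_smul_comm, smul_mul_assoc, CFC.abs_smul,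
    Real.norm_of_nonneg hc, smul_rpow (op_abs_nonneg _) hc, ← Complex.coe_smul, map_smul,
    smul_eq_mul, Complex.re_ofReal_mul]
  have h := re_tr_rpow_nonneg (CFC.abs (σ ^ (1 / (2 * p)) * X * σ ^ (1 / (2 * p)))) p
  rw [Real.mul_rpow (Real.rpow_nonneg hc p) h, ← Real.rpow_mul hc, mul_one_div_cancel hp.ne',
    Real.rpow_one]

theorem wNorm_of_commute {σ A : H →L[ℂ] H} {p : ℝ} (hp : 0 < p)
    (hA : Commute σ A) : wNorm σ (ENNReal.ofReal p) A =
      (tr ((star (σ ^ (1 / (2 * p)) * (σ ^ (1 / (2 * p)) * A)) *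
        (σ ^ (1 / (2 * p)) * (σ ^ (1 / (2 * p)) * A))) ^ (p / 2))).re ^ (1 / p) := by
  rw [wNorm_ofReal σ A hp, abs_rpow _ hp.le, mul_assoc, (commute_rpow hA _).eq]

theorem wNorm_proj {σ P : H →L[ℂ] H} (hσ : 0 ≤ σ) (hP : IsStarProjection P) {p : ℝ} (hp : 0 < p)
    (hσP : Commute σ P) : wNorm σ (ENNReal.ofReal p) P = (tr (σ * P)).re ^ (1 / p) := by
  have h : σ ^ (1 / (2 * p)) * P * σ ^ (1 / (2 * p)) = (σ * P) ^ (1 / p) := by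
    rw [mul_proj_rpow hσ hP hσP (by positivity), mul_assoc, ← (commute_rpow hσP _).eq, ← mul_assoc,
      rpow_mul_rpow hσ (by positivity) (by positivity)]
    congr 2; field_simp; norm_num
  have h0 := mul_nonneg_of_commute_proj hσ hP hσP
  have h1 : ((σ * P) ^ (1 / p)) ^ p = σ * P := by
    rw [CFC.rpow_rpow_of_exponent_nonneg _ _ _ (by positivity) hp.le h0, one_div_mul_cancel hp.ne',
      CFC.rpow_one _ h0]
  rw [wNorm_ofReal σ P hp, h, op_abs_of_nonneg (op_rpow_nonneg _ _), h1]

end WeightedNorm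

/-! ### Minimal projections and off-diagonal elements -/

section Projections

variable {N : StarSubalgebra ℂ (H →L[ℂ] H)} {E : (H →L[ℂ] H) →CP (H →L[ℂ] H)}

theorem cfc_mem_starSubalgebra {A : H →L[ℂ] H} (hA : A ∈ N) (f : ℝ → ℝ) : cfc f A ∈ N := by
  have : IsClosed (N : Set (H →L[ℂ] H)) :=
    Submodule.closed_of_finiteDimensional (Subalgebra.toSubmodule N.toSubalgebra)
  exact cfc_mem f hA

/-- A nonzero self-adjoint element has a nonzero spectral projection below its support. -/
theorem exists_spectral_proj {a : H →L[ℂ] H} (ha : IsSelfAdjoint a) (h0 : a ≠ 0) :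
    ∃ (c : ℝ) (f g : ℝ → ℝ), IsStarProjection (cfc f a) ∧ cfc f a ≠ 0 ∧
      cfc f a = a * cfc g a ∧ a * cfc f a = c • cfc f a := by
  have hcont := fun f : ℝ → ℝ => continuousOn_spectrum f a
  have hid : cfc (fun x : ℝ => x) a = a := cfc_id' ℝ a ha
  obtain ⟨c, hc, hc0⟩ : ∃ c ∈ spectrum ℝ a, c ≠ 0 := by
    by_contra! h
    refine h0 ?_
    rw [← hid, ← cfc_zero ℝ a]
    exact cfc_congr fun x hx => h x hx
  -- The projection is the indicator of a nonzero spectral value c. The second function divides it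
  -- by c, exhibiting the projection as a multiple of a, so that it lies below any projection P with
  -- P a = a.
  refine ⟨c, fun x => if x = c then 1 else 0, fun x => if x = c then c⁻¹ else 0,
    ⟨?_, IsSelfAdjoint.cfc⟩, ?_, ?_, ?_⟩
  · rw [IsIdempotentElem, ← cfc_mul _ _ a (hcont _) (hcont _)]
    exact cfc_congr fun x _ => by simp
  · intro hz
    have h1 := cfc_map_spectrum (fun x : ℝ => if x = c then 1 else 0) a ha (hcont _)
    have h2 : (1 : ℝ) ∈ spectrum ℝ (cfc (fun x : ℝ => if x = c then (1 : ℝ) else 0) a) := by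
      rw [h1]; exact ⟨c, hc, by simp⟩
    rw [hz] at h2
    have : Nontrivial (H →L[ℂ] H) := ⟨a, 0, h0⟩
    rw [spectrum.zero_eq] at h2
    exact one_ne_zero h2
  · nth_rw 2 [← hid]
    rw [← cfc_mul _ _ a (hcont _) (hcont _)]
    refine cfc_congr fun x _ => ?_
    by_cases hx : x = c
    · simp [hx, hc0]
    · simp [hx]
  · nth_rw 1 [← hid]
    rw [← cfc_mul _ _ a (hcont _) (hcont _), ← cfc_smul _ _ a (hcont _)]
    refine cfc_congr fun x _ => ?_
    by_cases hx : x = c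
    · simp [hx]
    · simp [hx]

theorem eq_of_finrank_range_le {P R : H →L[ℂ] H} (hP : IsStarProjection P)
    (hR : IsStarProjection R) (hPR : P * R = R)
    (h : Module.finrank ℂ (P : H →ₗ[ℂ] H).range ≤ Module.finrank ℂ (R : H →ₗ[ℂ] H).range) :
    R = P := by
  have hle : (R : H →ₗ[ℂ] H).range ≤ (P : H →ₗ[ℂ] H).range := by
    rintro _ ⟨x, rfl⟩
    refine ⟨R x, ?_⟩
    exact congrArg (fun A : H →L[ℂ] H => A x) hPR
  have heq := Submodule.eq_of_le_of_finrank_le hle h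
  have h1 : R * P = P := by
    ext x
    obtain ⟨y, hy⟩ : P x ∈ (R : H →ₗ[ℂ] H).range := heq ▸ ⟨x, rfl⟩
    have hy' : R y = P x := hy
    rw [mul_apply_eq_comp, ← hy', ← mul_apply_eq_comp, hR.isIdempotentElem.eq]
  have h2 : R * P = R := by
    have := congrArg star hPR
    rwa [star_mul, hP.isSelfAdjoint.star_eq, hR.isSelfAdjoint.star_eq] at this
  rw [← h2, h1]

theorem mem_bot_of_forall_selfAdjoint
    (h : ∀ A ∈ N, IsSelfAdjoint A → ∃ c : ℝ, A = c • 1) : N = ⊥ := by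
  refine eq_bot_iff.2 fun A hA => ?_
  obtain ⟨c, hc⟩ := h (A + star A) (add_mem hA (star_mem hA)) (.add_star_self A)
  obtain ⟨d, hd⟩ := h (Complex.I • (A - star A)) (N.smul_mem (sub_mem hA (star_mem hA)) _) (by
    rw [isSelfAdjoint_iff, star_smul, star_sub, star_star, Complex.star_def, Complex.conj_I,
      neg_smul, ← smul_neg, neg_sub])
  rw [StarSubalgebra.mem_bot]
  refine ⟨(c - Complex.I * d) / 2, ?_⟩
  have h2 : A - star A = (-Complex.I) • (Complex.I • (A - star A)) := by
    rw [smul_smul]; simp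
  have h3 : A = (1 / 2 : ℂ) • ((A + star A) + (A - star A)) := by
    rw [add_add_sub_cancel, ← two_smul ℂ A, smul_smul]; norm_num
  rw [h2, hc, hd] at h3
  rw [h3, Algebra.algebraMap_eq_smul_one, ← Complex.coe_smul, ← Complex.coe_smul, smul_smul,
    ← add_smul, smul_smul]
  congr 1; ring

/-- P is a nonzero projection of N of least rank. A spectral projection of a nonzero compression P A
P lies below P and in N, hence equals P, so the compression is scalar. If P were 1, all of N would
be scalar. -/
theorem exists_minimal_proj (hN : N ≠ ⊥) : ∃ P ∈ N, IsStarProjection P ∧ P ≠ 0 ∧ P ≠ 1 ∧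
    ∀ A ∈ N, IsSelfAdjoint A → ∃ c : ℝ, P * A * P = c • P := by
  classical
  have hnt : (1 : H →L[ℂ] H) ≠ 0 := by
    intro h1
    refine hN (mem_bot_of_forall_selfAdjoint fun A _ _ => ⟨0, ?_⟩)
    rw [zero_smul, ← mul_one A, h1, mul_zero]
  have hex : ∃ n, ∃ P ∈ N, IsStarProjection P ∧ P ≠ 0 ∧
      Module.finrank ℂ (P : H →ₗ[ℂ] H).range = n :=
    ⟨_, 1, one_mem N, .one _, hnt, rfl⟩
  obtain ⟨P, hPN, hP, hP0, hPn⟩ := Nat.find_spec hex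
  have hmin : ∀ R ∈ N, IsStarProjection R → R ≠ 0 → P * R = R → R = P := fun R hRN hR hR0 hPR =>
    eq_of_finrank_range_le hP hR hPR (hPn ▸ Nat.find_min' hex ⟨R, hRN, hR, hR0, rfl⟩)
  have hsc : ∀ A ∈ N, IsSelfAdjoint A → ∃ c : ℝ, P * A * P = c • P := by
    intro A hA hAs
    set a := P * A * P with ha
    have haN : a ∈ N := mul_mem (mul_mem hPN hA) hPN
    have has : IsSelfAdjoint a := by
      rw [isSelfAdjoint_iff, ha, star_mul, star_mul, hP.isSelfAdjoint.star_eq, hAs.star_eq,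
        mul_assoc]
    by_cases h0 : a = 0
    · exact ⟨0, by rw [h0, zero_smul]⟩
    obtain ⟨c, f, g, hf, hf0, hfg, hfc⟩ := exists_spectral_proj has h0
    have hPa : P * a = a := by rw [ha, ← mul_assoc, ← mul_assoc, hP.isIdempotentElem.eq]
    have haP : a * P = a := by rw [ha, mul_assoc, hP.isIdempotentElem.eq]
    have hfP := hmin _ (cfc_mem_starSubalgebra haN f) hf hf0 (by rw [hfg, ← mul_assoc, hPa])
    rw [hfP, haP] at hfc
    exact ⟨c, hfc⟩
  refine ⟨P, hPN, hP, hP0, ?_, hsc⟩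
  rintro rfl
  refine hN (mem_bot_of_forall_selfAdjoint fun A hA hAs => ?_)
  simpa using hsc A hA hAs

theorem star_rankOne (x y : H) :
    star (InnerProductSpace.rankOne ℂ x y) = InnerProductSpace.rankOne ℂ y x := by
  rw [ContinuousLinearMap.star_eq_adjoint, InnerProductSpace.adjoint_rankOne]

theorem mul_rankOne (A : H →L[ℂ] H) (x y : H) :
    A * InnerProductSpace.rankOne ℂ x y = InnerProductSpace.rankOne ℂ (A x) y := by
  ext z; simp

theorem rankOne_mul (A : H →L[ℂ] H) (x y : H) :
    InnerProductSpace.rankOne ℂ x y * A = InnerProductSpace.rankOne ℂ x (star A y) := by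
  rw [← star_star (InnerProductSpace.rankOne ℂ x y * A), star_mul, star_rankOne, mul_rankOne,
    star_rankOne]

/-- Products of two off-diagonal rank-one operators fill the two diagonal corners, provided neither
P nor 1 - P vanishes. -/
theorem eq_top_of_offdiag_mem {P : H →L[ℂ] H} (hP : IsStarProjection P) (hP0 : P ≠ 0)
    (hP1 : P ≠ 1) (h : ∀ Y : H →L[ℂ] H, P * Y * (1 - P) ∈ N) : N = ⊤ := by
  have hQ := hP.one_sub
  have huv : ∀ x y, InnerProductSpace.rankOne ℂ (P x) ((1 - P) y) ∈ N := fun x y => by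
    have := h (InnerProductSpace.rankOne ℂ x y)
    rwa [mul_rankOne, rankOne_mul, hQ.isSelfAdjoint.star_eq] at this
  have hvu : ∀ x y, InnerProductSpace.rankOne ℂ ((1 - P) x) (P y) ∈ N := fun x y => by
    rw [← star_rankOne]
    exact star_mem (huv y x)
  have hcomp : ∀ x y z : H, z ≠ 0 → InnerProductSpace.rankOne ℂ x z ∈ N →
      InnerProductSpace.rankOne ℂ z y ∈ N → InnerProductSpace.rankOne ℂ x y ∈ N := by
    intro x y z hz h1 h2
    have h3 : InnerProductSpace.rankOne ℂ x y = (inner ℂ z z)⁻¹ •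
        (InnerProductSpace.rankOne ℂ x z * InnerProductSpace.rankOne ℂ z y) := by
      rw [mul_rankOne, InnerProductSpace.rankOne_apply]
      ext w
      have hz' : inner ℂ z z ≠ 0 := inner_self_ne_zero.2 hz
      simp only [smul_apply, InnerProductSpace.rankOne_apply, smul_smul]
      congr 1
      field_simp
    rw [h3]
    exact N.smul_mem (mul_mem h1 h2) _
  obtain ⟨u, hu⟩ : ∃ u, P u ≠ 0 := by
    by_contra! h0
    exact hP0 (by ext x; simpa using h0 x)
  obtain ⟨v, hv⟩ : ∃ v, (1 - P) v ≠ 0 := by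
    by_contra! h0
    refine hP1 (ContinuousLinearMap.ext fun x => ?_)
    have hx := h0 x
    rw [sub_apply, sub_eq_zero] at hx
    exact hx.symm
  have hall : ∀ x y, InnerProductSpace.rankOne ℂ x y ∈ N := by
    intro x y
    have hx : x = P x + (1 - P) x := by simp
    have hy : y = P y + (1 - P) y := by simp
    have h4 : InnerProductSpace.rankOne ℂ x y =
        InnerProductSpace.rankOne ℂ (P x) (P y) + InnerProductSpace.rankOne ℂ (P x) ((1 - P) y) +
        (InnerProductSpace.rankOne ℂ ((1 - P) x) (P y) +
          InnerProductSpace.rankOne ℂ ((1 - P) x) ((1 - P) y)) := by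
      conv_lhs => rw [hx, hy]
      simp only [map_add, add_apply]
      abel
    rw [h4]
    exact add_mem (add_mem (hcomp _ _ _ hv (huv x v) (hvu v y)) (huv x y))
      (add_mem (hvu x y) (hcomp _ _ _ hu (hvu x u) (huv u y)))
  refine eq_top_iff.2 fun Y _ => ?_
  rw [eq_sum_rankOne Y]
  exact sum_mem fun i _ => sum_mem fun j _ => N.smul_mem (hall _ _) _

/-- For an off-diagonal A, the difference A - E A is again off-diagonal, since P and 1 - P lie in N,
and E annihilates it. If all such differences vanished, every off-diagonal operator would be in N.
-/
theorem IsCondExp.exists_offdiag (hE : IsCondExp N E) (hN : N ≠ ⊤) {P : H →L[ℂ] H} (hPN : P ∈ N)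
    (hP : IsStarProjection P) (hP0 : P ≠ 0) (hP1 : P ≠ 1) :
    ∃ Z, Z ≠ 0 ∧ P * Z = Z ∧ Z * (1 - P) = Z ∧ E Z = 0 := by
  by_contra! hcon
  refine hN (eq_top_of_offdiag_mem hP hP0 hP1 fun Y => ?_)
  set A := P * Y * (1 - P) with hA
  have hQN : 1 - P ∈ N := sub_mem (one_mem N) hPN
  have hPA : P * A = A := by rw [hA, ← mul_assoc, ← mul_assoc, hP.isIdempotentElem.eq]
  have hAQ : A * (1 - P) = A := by rw [hA, mul_assoc, hP.one_sub.isIdempotentElem.eq]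
  by_cases h0 : A - E A = 0
  · rw [sub_eq_zero.1 h0]
    exact hE.mem A
  · refine absurd ?_ (hcon (A - E A) h0 ?_ ?_)
    · rw [map_sub, hE.map_of_mem (hE.mem A), sub_self]
    · rw [mul_sub, hPA, ← hE.map_mul_left hPN, hPA]
    · rw [sub_mul, hAQ, ← hE.map_mul_right hQN, hAQ]

end Projections

/-! ### Second-order perturbation of a minimal projection -/

theorem norm_proj_le {P : H →L[ℂ] H} (hP : IsStarProjection P) : ‖P‖ ≤ 1 :=
  hP.norm_le

theorem rpow_add_of_isStrictlyPositive {σ : H →L[ℂ] H} (hσ : IsStrictlyPositive σ) (x y : ℝ) :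
    σ ^ x * σ ^ y = σ ^ (x + y) :=
  (CFC.rpow_add hσ.isUnit).symm

theorem re_tr_star_add_mul_add (U V : H →L[ℂ] H) :
    (tr (star (U + V) * (U + V))).re =
      (tr (star U * U)).re + 2 * (tr (star U * V)).re + (tr (star V * V)).re := by
  have h : (tr (star V * U)).re = (tr (star U * V)).re := by
    rw [← re_tr_star, star_mul, star_star]
  rw [star_add, add_mul, mul_add, mul_add]
  simp only [map_add, Complex.add_re]
  rw [h]; ring

/-- The part of the perturbation linear in ε has size √(bβ), so its square is of order ε² b β and is
absorbed by the mixed term of the square on the right. The summand 1 gives C ≥ 1, so that s C ≤ s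
C². -/
theorem quadratic_le {s b β ε K₁ K₂ k : ℝ} (hs : 0 < s) (hb : 0 ≤ b) (hβ : 0 ≤ β)
    (hK₁ : 0 ≤ K₁) (hK₂ : 0 ≤ K₂) :
    b ^ 2 * s + 2 * (b * (ε ^ 2 * (K₁ * β))) + K₂ * (2 * ε * (k * √(b * β)) + ε ^ 2 * (k * β)) ^ 2 ≤
      s * (b + (1 + (K₁ + 4 * K₂ * k ^ 2) / s + 2 * K₂ * k ^ 2 / s) * ε ^ 2 * β) ^ 2 := by
  set C := 1 + (K₁ + 4 * K₂ * k ^ 2) / s + 2 * K₂ * k ^ 2 / s with hC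
  have h1 : K₁ + 4 * K₂ * k ^ 2 ≤ s * C := by
    have h : s * C = s + (K₁ + 4 * K₂ * k ^ 2) + 2 * K₂ * k ^ 2 := by rw [hC]; field_simp
    rw [h]; nlinarith [mul_nonneg hK₂ (sq_nonneg k)]
  have h2 : 2 * K₂ * k ^ 2 ≤ s * C ^ 2 := by
    have hC1 : 1 ≤ C := by
      have : 0 ≤ (K₁ + 4 * K₂ * k ^ 2) / s := by positivity
      have : 0 ≤ 2 * K₂ * k ^ 2 / s := by positivity
      linarith
    have h : s * C = s + (K₁ + 4 * K₂ * k ^ 2) + 2 * K₂ * k ^ 2 := by rw [hC]; field_simp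
    have h3 : 2 * K₂ * k ^ 2 ≤ s * C := by rw [h]; nlinarith [mul_nonneg hK₂ (sq_nonneg k)]
    calc _ ≤ s * C := h3
      _ ≤ s * C * C := le_mul_of_one_le_right (by positivity) hC1
      _ = _ := by ring
  have h3 : (2 * ε * (k * √(b * β)) + ε ^ 2 * (k * β)) ^ 2 ≤
      2 * (2 * ε * (k * √(b * β))) ^ 2 + 2 * (ε ^ 2 * (k * β)) ^ 2 := by
    nlinarith [sq_nonneg (2 * ε * (k * √(b * β)) - ε ^ 2 * (k * β))]
  have h4 : (2 * ε * (k * √(b * β))) ^ 2 = 4 * ε ^ 2 * k ^ 2 * (b * β) := by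
    rw [mul_pow, mul_pow k, Real.sq_sqrt (by positivity)]; ring
  rw [h4] at h3
  have h5 := mul_le_mul_of_nonneg_left h3 hK₂
  have h6 : (K₁ + 4 * K₂ * k ^ 2) * (b * ε ^ 2 * β) ≤ s * C * (b * ε ^ 2 * β) :=
    mul_le_mul_of_nonneg_right h1 (by positivity)
  have h7 : 2 * K₂ * k ^ 2 * (ε ^ 2 * β) ^ 2 ≤ s * C ^ 2 * (ε ^ 2 * β) ^ 2 :=
    mul_le_mul_of_nonneg_right h2 (by positivity)
  linarith

section Perturbation

variable {σ P Z : H →L[ℂ] H} {p r : ℝ}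

theorem norm_offdiag_le (A P Q : H →L[ℂ] H) :
    ‖star Q * (star A * A) * P‖ ≤ √(‖star P * (star A * A) * P‖ * ‖star Q * (star A * A) * Q‖) := by
  have h : ∀ R : H →L[ℂ] H, ‖star R * (star A * A) * R‖ = ‖A * R‖ ^ 2 := fun R => by
    rw [sq, ← CStarRing.norm_star_mul_self, star_mul]; simp only [mul_assoc]
  have h1 : star Q * (star A * A) * P = star (A * Q) * (A * P) := by
    rw [star_mul]; simp only [mul_assoc]
  rw [h P, h Q, h1, ← mul_pow, Real.sqrt_sq (by positivity), mul_comm ‖A * P‖,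
    ← norm_star (A * Q)]
  exact norm_mul_le _ _

theorem nonneg_of_compression {B : H →L[ℂ] H} (hB : 0 ≤ B) (hP : IsStarProjection P) (hP0 : P ≠ 0)
    {b : ℝ} (hb : P * B * P = b • P) : 0 ≤ b := by
  have h1 := re_tr_nonneg (star_left_conjugate_nonneg hB P)
  rw [hP.isSelfAdjoint.star_eq, hb, ← Complex.coe_smul, map_smul, smul_eq_mul,
    Complex.re_ofReal_mul] at h1
  exact nonneg_of_mul_nonneg_left h1 (re_tr_pos hP.nonneg hP0)

set_option maxHeartbeats 2000000 in
/-- Second-order bound of the weighted Hilbert–Schmidt norm of a perturbation of a minimal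
projection. The first-order term vanishes by orthogonality. -/
theorem exists_weighted_two_le (hσ : IsStrictlyPositive σ) (hP : IsStarProjection P) (hP0 : P ≠ 0)
    (hσP : Commute σ P) (hPZ : P * Z = Z) (hZQ : Z * (1 - P) = Z) (hr : 1 / r = 1 / p - 1 / 2) :
    ∃ C : ℝ, 0 ≤ C ∧ ∀ (ε b : ℝ) (A : H →L[ℂ] H), 0 ≤ ε → Commute σ (star A * A) →
      P * (star A * A) * P = b • P → tr (σ * (Z * (star A * A) * P)) = 0 →
      (tr (star (σ ^ (-(1 / r)) * ((P + ε • Z) * (σ ^ (1 / p) * (star A * A)) * star (P + ε • Z))) *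
        (σ ^ (-(1 / r)) * ((P + ε • Z) * (σ ^ (1 / p) * (star A * A)) * star (P + ε • Z))))).re ≤
      (tr (σ * P)).re * (b + C * ε ^ 2 * ‖(1 - P) * (star A * A) * (1 - P)‖) ^ 2 := by
  have hQ := hP.one_sub
  set Q := 1 - P
  set S := σ ^ (1 / p)
  set R := σ ^ (-(1 / r))
  set G := σ ^ (1 - 1 / p)
  have hs : 0 < (tr (σ * P)).re := by
    refine re_tr_pos (mul_nonneg_of_commute_proj hσ.nonneg hP hσP) fun h0 => hP0 ?_
    exact (hσ.isUnit.mul_right_eq_zero).1 h0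
  set s := (tr (σ * P)).re
  set d : ℝ := (Module.finrank ℂ H : ℝ)
  -- The factor 1 + ‖Z‖ lets k dominate both ‖Z‖‖S‖, for the first-order term, and ‖Z‖‖S‖‖Z‖, for
  -- the second-order one.
  set k : ℝ := ‖Z‖ * ‖S‖ * (1 + ‖Z‖)
  set K₁ : ℝ := d * (‖G‖ * (‖Z‖ * ‖S‖ * ‖Z‖))
  set K₂ : ℝ := d * ‖R‖ ^ 2
  refine ⟨1 + (K₁ + 4 * K₂ * k ^ 2) / s + 2 * K₂ * k ^ 2 / s, by positivity, ?_⟩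
  intro ε b A hε hσB hb hcross
  have hB0 : 0 ≤ star A * A := star_mul_self_nonneg A
  have hb0 : 0 ≤ b := nonneg_of_compression hB0 hP hP0 hb
  have hoff := norm_offdiag_le A P Q
  set B := star A * A
  set β := ‖Q * B * Q‖
  rw [hP.isSelfAdjoint.star_eq, hQ.isSelfAdjoint.star_eq, hb] at hoff
  have hoff' : ‖Q * B * P‖ ≤ √(b * β) := by
    refine hoff.trans (Real.sqrt_le_sqrt ?_)
    refine mul_le_mul_of_nonneg_right ?_ (norm_nonneg _)
    rw [norm_smul, Real.norm_of_nonneg hb0]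
    exact mul_le_of_le_one_right hb0 (norm_proj_le hP)
  clear_value B
  have hSB : Commute S B := commute_rpow hσB _
  have hSP : Commute S P := commute_rpow hσP _
  have hSQ : Commute S Q := (Commute.one_right S).sub_right hSP
  have hGP : Commute G P := commute_rpow hσP _
  have hRs : star R = R := (rpow_isSelfAdjoint σ _).star_eq
  have hSs : star S = S := (rpow_isSelfAdjoint σ _).star_eq
  have hGs : star G = G := (rpow_isSelfAdjoint σ _).star_eq
  have hPs : star P = P := hP.isSelfAdjoint.star_eq
  have hQs : star Q = Q := hQ.isSelfAdjoint.star_eq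
  have hBs : star B = B := hB0.isSelfAdjoint.star_eq
  -- The relation between r and p reads 1/p - 2/r = 1 - 1/p.
  have hSRR : S * (R * R) = G := by
    rw [rpow_add_of_isStrictlyPositive hσ, rpow_add_of_isStrictlyPositive hσ]
    congr 1; rw [hr]; ring
  have hGS : S * G = σ := by
    rw [rpow_add_of_isStrictlyPositive hσ, add_sub_cancel, CFC.rpow_one σ hσ.nonneg]
  have hGS' : G * S = σ := by
    rw [rpow_add_of_isStrictlyPositive hσ, sub_add_cancel, CFC.rpow_one σ hσ.nonneg]
  set D := Z * (S * B) * P with hD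
  set F := Z * (S * B) * star Z with hF
  set Δ := ε • (D + star D) + (ε ^ 2) • F with hΔ
  have hDs : star D = P * (S * B) * star Z := by
    rw [hD, star_mul, star_mul, star_mul, hPs, hBs, hSs, hSB.eq]
    simp only [mul_assoc]
  have hT : (P + ε • Z) * (S * B) * star (P + ε • Z) = b • (S * P) + Δ := by
    have h1 : P * (S * B) * P = b • (S * P) := by
      rw [← mul_assoc, ← hSP.eq, mul_assoc, mul_assoc, ← mul_assoc P, hb, mul_smul_comm]
    have h2 : star (P + ε • Z) = P + ε • star Z := by rw [star_add, star_smul, hPs]; simp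
    rw [h2, add_mul, add_mul, mul_add, mul_add, h1, hΔ, hDs, hD, hF]
    simp only [smul_mul_assoc, mul_smul_comm, smul_add, smul_smul]
    rw [sq]; abel
  have hDle : ‖D‖ ≤ k * √(b * β) := by
    have h1 : D = Z * S * (Q * B * P) := by
      rw [hD]; conv_lhs => rw [← hZQ]
      simp only [mul_assoc]
      rw [← mul_assoc Q S, ← hSQ.eq, mul_assoc]
    rw [h1]
    calc _ ≤ ‖Z‖ * ‖S‖ * ‖Q * B * P‖ :=
          (norm_mul_le _ _).trans (mul_le_mul_of_nonneg_right (norm_mul_le _ _) (norm_nonneg _))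
      _ ≤ ‖Z‖ * ‖S‖ * √(b * β) := mul_le_mul_of_nonneg_left hoff' (by positivity)
      _ ≤ k * √(b * β) := mul_le_mul_of_nonneg_right
          (le_mul_of_one_le_right (by positivity) (by linarith [norm_nonneg Z])) (by positivity)
  have hFle : ‖F‖ ≤ ‖Z‖ * ‖S‖ * ‖Z‖ * β := by
    have h1 : F = Z * S * (Q * B * Q) * star Z := by
      rw [hF]; conv_lhs => rw [← hZQ, star_mul, hQs]
      simp only [mul_assoc]
      rw [← mul_assoc Q S, ← hSQ.eq, mul_assoc]
    rw [h1]
    calc _ ≤ ‖Z * S‖ * ‖Q * B * Q‖ * ‖star Z‖ := norm_mul₃_le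
      _ ≤ ‖Z‖ * ‖S‖ * β * ‖Z‖ := by
          rw [norm_star]
          exact mul_le_mul_of_nonneg_right
            (mul_le_mul_of_nonneg_right (norm_mul_le _ _) (norm_nonneg _)) (norm_nonneg _)
      _ = _ := by ring
  have hΔle : ‖Δ‖ ≤ 2 * ε * (k * √(b * β)) + ε ^ 2 * (k * β) := by
    have h1 : ‖F‖ ≤ k * β := hFle.trans (mul_le_mul_of_nonneg_right
      (mul_le_mul_of_nonneg_left (by linarith) (by positivity)) (norm_nonneg _))
    calc ‖Δ‖ ≤ ε * (‖D‖ + ‖D‖) + ε ^ 2 * ‖F‖ := by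
          refine (norm_add_le _ _).trans ?_
          rw [norm_smul, norm_smul, Real.norm_of_nonneg hε, Real.norm_of_nonneg (sq_nonneg ε)]
          have := norm_add_le D (star D)
          rw [norm_star] at this
          gcongr
      _ ≤ ε * (k * √(b * β) + k * √(b * β)) + ε ^ 2 * (k * β) := by gcongr
      _ = _ := by ring
  have hUU : (tr (star (R * (b • (S * P))) * (R * (b • (S * P))))).re = b ^ 2 * s := by
    have h1 : star (R * (b • (S * P))) * (R * (b • (S * P))) = (b ^ 2) • (P * (σ * P)) := by
      rw [star_mul, star_smul, star_mul, hRs, hSs, hPs]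
      simp only [smul_mul_assoc, mul_smul_comm, smul_smul, star_trivial]
      congr 1
      · ring
      · calc P * S * R * (R * (S * P)) = P * (S * (R * R) * S) * P := by simp only [mul_assoc]
          _ = _ := by rw [hSRR, hGS', mul_assoc]
    rw [h1, ← Complex.coe_smul, map_smul, smul_eq_mul, Complex.re_ofReal_mul, tr_mul_comm,
      mul_assoc, hP.isIdempotentElem.eq]
  -- The first-order pairing with the leading term collapses to Tr(σ Z B P), because S G = σ and S
  -- commutes with B and P.
  have hGD : tr (P * G * D) = 0 := by
    rw [← hcross, hD, ← hGP.eq]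
    calc tr (G * P * (Z * (S * B) * P)) = tr (G * (Z * B * P * S)) := by
          have h : S * B * P = B * P * S := by rw [hSB.eq, mul_assoc, hSP.eq, ← mul_assoc]
          refine congrArg tr ?_
          calc _ = G * ((P * Z) * (S * B * P)) := by simp only [mul_assoc]
            _ = G * (Z * (B * P * S)) := by rw [hPZ, h]
            _ = _ := by simp only [mul_assoc]
      _ = _ := by
          rw [← mul_assoc, tr_mul_comm, ← mul_assoc, hGS]
  have hGD' : (tr (P * G * star D)).re = 0 := by
    rw [← re_tr_star, star_mul, star_star, star_mul, hGs, hPs, hGP.eq, tr_mul_comm, hGD]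
    rfl
  have hUV : (tr (star (R * (b • (S * P))) * (R * Δ))).re ≤ b * (ε ^ 2 * (K₁ * β)) := by
    have h1 : star (R * (b • (S * P))) * (R * Δ) = b • (P * G * Δ) := by
      rw [star_mul, star_smul, star_mul, hRs, hSs, hPs]
      simp only [smul_mul_assoc, star_trivial]
      congr 1
      rw [← hSRR]; simp only [mul_assoc]
    have h2 : (tr (P * G * Δ)).re = ε ^ 2 * (tr (P * G * F)).re := by
      rw [hΔ, mul_add, mul_smul_comm, mul_smul_comm, mul_add, ← Complex.coe_smul,
        ← Complex.coe_smul, map_add, map_smul, map_smul, map_add, hGD, zero_add, smul_eq_mul,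
        smul_eq_mul, Complex.add_re, Complex.re_ofReal_mul, Complex.re_ofReal_mul, hGD']
      ring
    have h3 : (tr (P * G * F)).re ≤ K₁ * β := by
      refine (re_tr_le _).trans ?_
      have h4 : ‖P * G * F‖ ≤ ‖G‖ * (‖Z‖ * ‖S‖ * ‖Z‖ * β) := by
        calc _ ≤ ‖P‖ * ‖G‖ * ‖F‖ := norm_mul₃_le
          _ ≤ 1 * ‖G‖ * (‖Z‖ * ‖S‖ * ‖Z‖ * β) := by gcongr; exact norm_proj_le hP
          _ = _ := by ring
      calc _ ≤ d * (‖G‖ * (‖Z‖ * ‖S‖ * ‖Z‖ * β)) := mul_le_mul_of_nonneg_left h4 (by positivity)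
        _ = _ := by ring
    rw [h1, ← Complex.coe_smul, map_smul, smul_eq_mul, Complex.re_ofReal_mul, h2]
    gcongr
  have hVV : (tr (star (R * Δ) * (R * Δ))).re ≤
      K₂ * (2 * ε * (k * √(b * β)) + ε ^ 2 * (k * β)) ^ 2 := by
    refine (re_tr_le _).trans ?_
    rw [CStarRing.norm_star_mul_self, ← sq]
    calc d * ‖R * Δ‖ ^ 2 ≤ d * (‖R‖ * (2 * ε * (k * √(b * β)) + ε ^ 2 * (k * β))) ^ 2 := by
          gcongr
          exact (norm_mul_le _ _).trans (mul_le_mul_of_nonneg_left hΔle (norm_nonneg _))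
      _ = _ := by ring
  rw [hT, mul_add, re_tr_star_add_mul_add, hUU]
  refine le_trans ?_ (quadratic_le (k := k) (ε := ε) hs hb0 (norm_nonneg (Q * B * Q))
    (by positivity : 0 ≤ K₁) (by positivity : 0 ≤ K₂))
  linarith

end Perturbation

/-! ### Upper bound for the perturbed Schatten norm -/

section UpperBound

variable {σ P Z : H →L[ℂ] H} {p r r' : ℝ}

theorem commute_star_of_nonneg {A : H →L[ℂ] H} (hσ : 0 ≤ σ) (h : Commute σ A) :
    Commute σ (star A) := by
  have := h.star_star
  rwa [hσ.isSelfAdjoint.star_eq] at this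

theorem wNorm_star {q : ℝ} (hq : 0 < q) (X : H →L[ℂ] H) :
    wNorm σ (ENNReal.ofReal q) (star X) = wNorm σ (ENNReal.ofReal q) X := by
  have h : σ ^ (1 / (2 * q)) * star X * σ ^ (1 / (2 * q)) =
      star (σ ^ (1 / (2 * q)) * X * σ ^ (1 / (2 * q))) := by
    rw [star_mul, star_mul, (rpow_isSelfAdjoint σ _).star_eq, mul_assoc]
  rw [wNorm_ofReal σ _ hq, wNorm_ofReal σ _ hq, h, abs_rpow _ hq.le, abs_rpow _ hq.le, star_star,
    re_tr_rpow_star_mul_self _ (by positivity)]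

theorem norm_le_mul_re_tr (hσ : IsStrictlyPositive σ) {Y : H →L[ℂ] H} (hY : 0 ≤ Y) :
    ‖Y‖ ≤ ‖σ ^ (-(1 / 2) : ℝ)‖ ^ 2 * (tr (σ * Y)).re := by
  set R := σ ^ (-(1 / 2) : ℝ)
  set S := σ ^ (1 / 2 : ℝ)
  have hSs : star S = S := (rpow_isSelfAdjoint σ _).star_eq
  have h0 : 0 ≤ S * Y * S := by
    have := star_left_conjugate_nonneg hY S
    rwa [hSs] at this
  have h1 : tr (S * Y * S) = tr (σ * Y) := by
    rw [tr_mul_comm, ← mul_assoc, rpow_add_of_isStrictlyPositive hσ]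
    norm_num [CFC.rpow_one σ hσ.nonneg]
  have h2 : Y = R * (S * Y * S) * R := by
    have h3 : R * S = 1 := CFC.rpow_neg_mul_rpow _ hσ
    have h4 : S * R = 1 := CFC.rpow_mul_rpow_neg _ hσ
    calc Y = (R * S) * Y * (S * R) := by rw [h3, h4, one_mul, mul_one]
      _ = _ := by simp only [mul_assoc]
  have h5 := norm_le_re_tr h0
  rw [h1] at h5
  calc ‖Y‖ = ‖R * (S * Y * S) * R‖ := by rw [← h2]
    _ ≤ ‖R‖ * ‖S * Y * S‖ * ‖R‖ := norm_mul₃_le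
    _ = ‖R‖ ^ 2 * ‖S * Y * S‖ := by ring
    _ ≤ _ := mul_le_mul_of_nonneg_left h5 (by positivity)

/-- Hölder for σ^(1/r) A*A against the r'-th root of G = σP + δ^r' σ(1 - P). This G is chosen so
that the root is σ^(1/r') (P + δ(1 - P)), which turns the left side into a single trace. -/
theorem re_tr_compression_le (hσ : IsStrictlyPositive σ) (hP : IsStarProjection P)
    (hσP : Commute σ P) (hr : r.HolderConjugate r') {A : H →L[ℂ] H} (hA : Commute σ A) {δ : ℝ}
    (hδ : 0 ≤ δ) :
    (tr (σ * (star A * A) * P)).re + δ * (tr (σ * (star A * A) * (1 - P))).re ≤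
      wNorm σ (ENNReal.ofReal (2 * r)) A ^ 2 *
        ((tr (σ * P)).re + δ ^ r' * (tr (σ * (1 - P))).re) ^ (1 / r') := by
  have hr0 := hr.pos
  have hr0' := hr.symm.pos
  have hQ := hP.one_sub
  have hPQ : P * (1 - P) = 0 := by rw [mul_sub, hP.isIdempotentElem.eq, mul_one, sub_self]
  have hQP : (1 - P) * P = 0 := by rw [sub_mul, hP.isIdempotentElem.eq, one_mul, sub_self]
  have hPQ1 : P + (1 - P) = 1 := add_sub_cancel P 1
  have hσQ : Commute σ (1 - P) := (Commute.one_right σ).sub_right hσP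
  set Q := 1 - P
  clear_value Q
  have hA' := commute_star_of_nonneg hσ.nonneg hA
  have hsA := commute_rpow hA (1 / (2 * (2 * r)))
  have hsA' := commute_rpow hA' (1 / (2 * (2 * r)))
  have hB : star (σ ^ (1 / (2 * (2 * r))) * (σ ^ (1 / (2 * (2 * r))) * A)) *
      (σ ^ (1 / (2 * (2 * r))) * (σ ^ (1 / (2 * (2 * r))) * A)) =
      σ ^ (1 / r) * (star A * A) := by
    have h4 : σ ^ (1 / r) = σ ^ (1 / (2 * (2 * r))) * σ ^ (1 / (2 * (2 * r))) *
        (σ ^ (1 / (2 * (2 * r))) * σ ^ (1 / (2 * (2 * r)))) := by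
      simp only [rpow_add_of_isStrictlyPositive hσ]
      congr 1; field_simp; norm_num
    rw [h4, star_mul, star_mul, (rpow_isSelfAdjoint σ _).star_eq]
    generalize σ ^ (1 / (2 * (2 * r))) = s at hsA hsA'
    calc star A * s * s * (s * (s * A)) = star A * (s * s * (s * s)) * A := by
          simp only [mul_assoc]
      _ = _ := by
        rw [← ((hsA'.mul_left hsA').mul_left (hsA'.mul_left hsA')).eq, mul_assoc]
  have hwn : wNorm σ (ENNReal.ofReal (2 * r)) A ^ 2 =
      (tr ((σ ^ (1 / r) * (star A * A)) ^ r)).re ^ (1 / r) := by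
    rw [wNorm_of_commute (by positivity) hA, hB, mul_div_cancel_left₀ r two_ne_zero,
      ← Real.rpow_natCast, ← Real.rpow_mul (re_tr_rpow_nonneg _ _)]
    congr 1; push_cast; field_simp
  have hR0 : 0 ≤ σ ^ (1 / r) * (star A * A) := by
    rw [← hB]; exact star_mul_self_nonneg _
  have hc : 0 ≤ δ ^ r' := Real.rpow_nonneg hδ _
  have hG := add_smul_proj_rpow hσ.nonneg hP hQ hPQ1 hPQ hQP hσP hσQ hc (1 / r')
  rw [← Real.rpow_mul hδ, mul_one_div_cancel hr0'.ne', Real.rpow_one] at hG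
  set G := σ * P + δ ^ r' • (σ * Q) with hGdef
  have hG0 : 0 ≤ G := add_nonneg (mul_nonneg_of_commute_proj hσ.nonneg hP hσP)
    (smul_nonneg hc (mul_nonneg_of_commute_proj hσ.nonneg hQ hσQ))
  have hGr : (G ^ (1 / r')) ^ r' = G := by
    rw [CFC.rpow_rpow_of_exponent_nonneg G _ _ (by positivity) hr0'.le hG0,
      one_div_mul_cancel hr0'.ne', CFC.rpow_one G hG0]
  have h := re_tr_mul_le_holder hR0 (op_rpow_nonneg G (1 / r')) hr
  rw [hGr, ← hwn] at h
  have htrG : (tr G).re = (tr (σ * P)).re + δ ^ r' * (tr (σ * Q)).re := by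
    rw [hGdef, ← Complex.coe_smul, map_add, map_smul, smul_eq_mul, Complex.add_re,
      Complex.re_ofReal_mul]
  rw [htrG] at h
  refine le_trans (le_of_eq ?_) h
  have hss : ∀ Y, σ ^ (1 / r) * (star A * A) * (σ ^ (1 / r') * Y) = σ * (star A * A) * Y := by
    intro Y
    have hc2 : Commute (σ ^ (1 / r')) (star A * A) := commute_rpow (hA'.mul_right hA) _
    rw [← mul_assoc, mul_assoc (σ ^ (1 / r)), ← hc2.eq, ← mul_assoc (σ ^ (1 / r)),
      rpow_add_of_isStrictlyPositive hσ, hr.one_div_add_one_div, div_one,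
      CFC.rpow_one σ hσ.nonneg]
  rw [hG, mul_add, mul_smul_comm, hss, hss, ← Complex.coe_smul, map_add, map_smul, smul_eq_mul,
    Complex.add_re, Complex.re_ofReal_mul]

theorem exists_schatten_perturb_le (hσ : IsStrictlyPositive σ) (hP : IsStarProjection P)
    (hP0 : P ≠ 0) (hσP : Commute σ P) (hPZ : P * Z = Z) (hZQ : Z * (1 - P) = Z) (hp : 1 < p)
    (hpr : 1 / r = 1 / p - 1 / 2) (hr : r.HolderConjugate r') :
    ∃ κ : ℝ, 0 ≤ κ ∧ ∀ (ε b : ℝ) (A : H →L[ℂ] H), 0 ≤ ε → Commute σ A →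
      P * (star A * A) * P = b • P → tr (σ * (Z * (star A * A) * P)) = 0 →
      (tr (((P + ε • Z) * star A * σ ^ (1 / (2 * p)) *
        star ((P + ε • Z) * star A * σ ^ (1 / (2 * p)))) ^ p)).re ^ (1 / p) ≤
      (tr (σ * P)).re ^ (1 / r - 1 / 2) *
        ((tr (σ * P)).re + (κ * ε ^ 2) ^ r' * (tr (σ * (1 - P))).re) ^ (1 / r') *
        wNorm σ (ENNReal.ofReal (2 * r)) A ^ 2 := by
  obtain ⟨C, hC, hbound⟩ := exists_weighted_two_le hσ hP hP0 hσP hPZ hZQ hpr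
  have hp0 : 0 < p := by linarith
  have hs : 0 < (tr (σ * P)).re := by
    refine re_tr_pos (mul_nonneg_of_commute_proj hσ.nonneg hP hσP) fun h0 => hP0 ?_
    exact (hσ.isUnit.mul_right_eq_zero).1 h0
  set s := (tr (σ * P)).re
  set C₃ := ‖σ ^ (-(1 / 2) : ℝ)‖ ^ 2
  -- C is the second-order constant, and C₃ bounds β by Tr σ A*A (1 - P). With s factored in, κ ε²
  -- is exactly the δ of `re_tr_compression_le`.
  refine ⟨s * C * C₃, by positivity, ?_⟩
  intro ε b A hε hA hb hcross
  have hA' := commute_star_of_nonneg hσ.nonneg hA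
  have hcomp := re_tr_compression_le hσ hP hσP hr hA
    (show 0 ≤ s * C * C₃ * ε ^ 2 by positivity)
  have hbd := hbound ε b A hε (hA'.mul_right hA) hb hcross
  have hT : (P + ε • Z) * star A * σ ^ (1 / (2 * p)) *
      star ((P + ε • Z) * star A * σ ^ (1 / (2 * p))) =
      (P + ε • Z) * (σ ^ (1 / p) * (star A * A)) * star (P + ε • Z) := by
    have h1 : σ ^ (1 / p) = σ ^ (1 / (2 * p)) * σ ^ (1 / (2 * p)) := by
      rw [rpow_add_of_isStrictlyPositive hσ]
      congr 1; field_simp; norm_num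
    have h2 : Commute (σ ^ (1 / p)) (star A) := commute_rpow hA' _
    rw [← mul_assoc (σ ^ (1 / p)), h2.eq, h1, star_mul, star_mul, star_star,
      (rpow_isSelfAdjoint σ _).star_eq]
    simp only [mul_assoc]
  have hT0 : 0 ≤ (P + ε • Z) * (σ ^ (1 / p) * (star A * A)) * star (P + ε • Z) := by
    rw [← hT]; exact mul_star_self_nonneg _
  have hPT : P * ((P + ε • Z) * (σ ^ (1 / p) * (star A * A)) * star (P + ε • Z)) =
      (P + ε • Z) * (σ ^ (1 / p) * (star A * A)) * star (P + ε • Z) := by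
    rw [← mul_assoc, ← mul_assoc, mul_add, mul_smul_comm, hPZ, hP.isIdempotentElem.eq]
  rw [hT]
  refine (schatten_le_weighted_two hσ hP hσP hT0 hPT hp hr.pos hpr).trans ?_
  have hb0 : 0 ≤ b := nonneg_of_compression (star_mul_self_nonneg A) hP hP0 hb
  have hsb : (tr (σ * (star A * A) * P)).re = s * b := by
    have h1 : tr (σ * (star A * A) * P) = tr (σ * (P * (star A * A) * P)) := by
      rw [mul_assoc P, ← mul_assoc σ P, hσP.eq, mul_assoc P σ, tr_mul_comm P]
      simp only [mul_assoc]
      rw [hP.isIdempotentElem.eq]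
    rw [h1, hb, mul_smul_comm, ← Complex.coe_smul, map_smul, smul_eq_mul, Complex.re_ofReal_mul,
      mul_comm]
  have hQ := hP.one_sub
  have hσQ : Commute σ (1 - P) := (Commute.one_right σ).sub_right hσP
  have hβ : ‖(1 - P) * (star A * A) * (1 - P)‖ ≤
      C₃ * (tr (σ * (star A * A) * (1 - P))).re := by
    have h0 := star_left_conjugate_nonneg (star_mul_self_nonneg A) (1 - P)
    rw [hQ.isSelfAdjoint.star_eq] at h0
    refine (norm_le_mul_re_tr hσ h0).trans_eq ?_
    have h1 : tr (σ * (star A * A) * (1 - P)) =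
        tr (σ * ((1 - P) * (star A * A) * (1 - P))) := by
      rw [mul_assoc (1 - P), ← mul_assoc σ (1 - P), hσQ.eq, mul_assoc (1 - P) σ,
        tr_mul_comm (1 - P)]
      simp only [mul_assoc]
      rw [hQ.isIdempotentElem.eq]
    rw [h1]
  rw [hsb] at hcomp
  set β := ‖(1 - P) * (star A * A) * (1 - P)‖
  have hβ0 : 0 ≤ β := norm_nonneg _
  have hsq : √s = s ^ (1 / 2 : ℝ) := Real.sqrt_eq_rpow s
  calc _ ≤ s ^ (1 / r) * √(s * (b + C * ε ^ 2 * β) ^ 2) :=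
        mul_le_mul_of_nonneg_left (Real.sqrt_le_sqrt hbd) (Real.rpow_nonneg hs.le _)
    _ = s ^ (1 / r - 1 / 2) * (s * b + s * C * ε ^ 2 * β) := by
        rw [Real.sqrt_mul hs.le, Real.sqrt_sq (by positivity), hsq]
        have h1 : s ^ (1 / r) * s ^ (1 / 2 : ℝ) = s ^ (1 / r - 1 / 2) * s := by
          rw [← Real.rpow_add hs]
          conv_rhs => rw [← Real.rpow_one s, ← Real.rpow_mul hs.le, ← Real.rpow_add hs]
          congr 1; ring
        rw [← mul_assoc, h1]; ring
    _ ≤ s ^ (1 / r - 1 / 2) * (s * b + s * C * C₃ * ε ^ 2 *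
          (tr (σ * (star A * A) * (1 - P))).re) := by
        refine mul_le_mul_of_nonneg_left ?_ (Real.rpow_nonneg hs.le _)
        have := mul_le_mul_of_nonneg_left hβ (show 0 ≤ s * C * ε ^ 2 by positivity)
        linarith
    _ ≤ _ := by
        rw [mul_assoc (s ^ (1 / r - 1 / 2))]
        refine mul_le_mul_of_nonneg_left (hcomp.trans_eq (mul_comm _ _)) (Real.rpow_nonneg hs.le _)

end UpperBound

/-! ### The amalgamated norm as a supremum -/

section AmalgamatedNorm

variable {N : StarSubalgebra ℂ (H →L[ℂ] H)} {E : (H →L[ℂ] H) →CP (H →L[ℂ] H)} {p r r' : ℝ}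

theorem two_mul_inv_sub_inv (hp : 1 < p) (hr : 0 < r) (hpr : 1 / r = 1 / p - 1 / 2) :
    2 * ((ENNReal.ofReal p)⁻¹ - 2⁻¹)⁻¹ = ENNReal.ofReal (2 * r) := by
  have h2 : (2 : ℝ≥0∞)⁻¹ = ENNReal.ofReal (1 / 2) := by
    rw [one_div, ENNReal.ofReal_inv_of_pos two_pos, ENNReal.ofReal_ofNat]
  rw [h2, ← ENNReal.ofReal_inv_of_pos (by linarith), ← ENNReal.ofReal_sub _ (by norm_num),
    inv_eq_one_div p, ← hpr, ← ENNReal.ofReal_inv_of_pos (by positivity), one_div, inv_inv,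
    ENNReal.ofReal_mul two_pos.le, ENNReal.ofReal_ofNat]

theorem amalgNorm_eq (hp : 1 < p) (hr : 0 < r) (hpr : 1 / r = 1 / p - 1 / 2) (Y : H →L[ℂ] H) :
    amalgNorm N E 2 (ENNReal.ofReal p) Y = sSup {c : ℝ | ∃ A ∈ N, ∃ B ∈ N, A ≠ 0 ∧ B ≠ 0 ∧
      c = wNorm (sigmaTr E) (ENNReal.ofReal p) (A * Y * B) /
        (wNorm (sigmaTr E) (ENNReal.ofReal (2 * r)) A *
          wNorm (sigmaTr E) (ENNReal.ofReal (2 * r)) B)} := by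
  rw [amalgNorm, two_mul_inv_sub_inv hp hr hpr]

theorem le_amalgNorm (hσ : IsStrictlyPositive (sigmaTr E)) (hp : 1 < p) (hr : 0 < r)
    (hpr : 1 / r = 1 / p - 1 / 2) (Y : H →L[ℂ] H) {A B : H →L[ℂ] H} (hA : A ∈ N) (hB : B ∈ N)
    (hA0 : A ≠ 0) (hB0 : B ≠ 0) :
    wNorm (sigmaTr E) (ENNReal.ofReal p) (A * Y * B) /
      (wNorm (sigmaTr E) (ENNReal.ofReal (2 * r)) A *
        wNorm (sigmaTr E) (ENNReal.ofReal (2 * r)) B) ≤ amalgNorm N E 2 (ENNReal.ofReal p) Y := by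
  have hr2 : 0 < 2 * r := by positivity
  obtain ⟨C₁, hC₁, h₁⟩ := exists_wNorm_le (sigmaTr E) (show 0 < p by linarith)
  obtain ⟨C₂, hC₂, h₂⟩ := exists_norm_le_wNorm hσ hr2
  rw [amalgNorm_eq hp hr hpr]
  refine le_csSup ⟨C₁ * C₂ * C₂ * ‖Y‖, ?_⟩ ⟨A, hA, B, hB, hA0, hB0, rfl⟩
  rintro _ ⟨A, -, B, -, hA0, hB0, rfl⟩
  have hmA := wNorm_pos hσ hr2 hA0
  have hmB := wNorm_pos hσ hr2 hB0
  rw [div_le_iff₀ (mul_pos hmA hmB)]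
  have hA := h₂ A
  have hB := h₂ B
  set a := wNorm (sigmaTr E) (ENNReal.ofReal (2 * r)) A
  set b := wNorm (sigmaTr E) (ENNReal.ofReal (2 * r)) B
  calc _ ≤ C₁ * ‖A * Y * B‖ := h₁ _
    _ ≤ C₁ * (‖A‖ * ‖Y‖ * ‖B‖) := by gcongr; exact norm_mul₃_le
    _ ≤ C₁ * ((C₂ * a) * ‖Y‖ * (C₂ * b)) := by gcongr
    _ = _ := by ring

theorem amalgNorm_nonneg (hp : 1 < p) (hr : 0 < r) (hpr : 1 / r = 1 / p - 1 / 2)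
    (Y : H →L[ℂ] H) : 0 ≤ amalgNorm N E 2 (ENNReal.ofReal p) Y := by
  rw [amalgNorm_eq hp hr hpr]
  refine Real.sSup_nonneg ?_
  rintro _ ⟨A, -, B, -, -, -, rfl⟩
  exact div_nonneg (wNorm_nonneg _ _ (by linarith))
    (mul_nonneg (wNorm_nonneg _ _ (by positivity)) (wNorm_nonneg _ _ (by positivity)))

/-- The sandwiched operator factors as (W A* σ^(1/2p))* (W B σ^(1/2p)), so Cauchy–Schwarz decouples
A from B and a one-sided estimate suffices. -/
theorem amalgNorm_star_mul_self_le
    (hp : 1 < p) (hr : 0 < r) (hpr : 1 / r = 1 / p - 1 / 2) (W : H →L[ℂ] H) {F : ℝ} (hF : 0 ≤ F)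
    (h : ∀ A ∈ N, (tr ((W * star A * sigmaTr E ^ (1 / (2 * p)) *
      star (W * star A * sigmaTr E ^ (1 / (2 * p)))) ^ p)).re ^ (1 / p) ≤
        F * wNorm (sigmaTr E) (ENNReal.ofReal (2 * r)) A ^ 2) :
    amalgNorm N E 2 (ENNReal.ofReal p) (star W * W) ≤ F := by
  have hr2 : 0 < 2 * r := by positivity
  rw [amalgNorm_eq hp hr hpr]
  refine Real.sSup_le ?_ hF
  rintro _ ⟨A, hA, B, hB, -, -, rfl⟩
  have hmA : 0 ≤ wNorm (sigmaTr E) (ENNReal.ofReal (2 * r)) A := wNorm_nonneg _ _ hr2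
  have hmB : 0 ≤ wNorm (sigmaTr E) (ENNReal.ofReal (2 * r)) B := wNorm_nonneg _ _ hr2
  refine div_le_of_le_mul₀ (mul_nonneg hmA hmB) hF ?_
  have hBs := h (star B) (star_mem hB)
  have hAs := h A hA
  rw [wNorm_star hr2, star_star] at hBs
  have hfac : sigmaTr E ^ (1 / (2 * p)) * (A * (star W * W) * B) * sigmaTr E ^ (1 / (2 * p)) =
      star (W * star A * sigmaTr E ^ (1 / (2 * p))) * (W * B * sigmaTr E ^ (1 / (2 * p))) := by
    rw [star_mul, star_mul, star_star, (rpow_isSelfAdjoint (sigmaTr E) _).star_eq]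
    simp only [mul_assoc]
  rw [wNorm_ofReal _ _ (by linarith), hfac]
  set a := wNorm (sigmaTr E) (ENNReal.ofReal (2 * r)) A
  set b := wNorm (sigmaTr E) (ENNReal.ofReal (2 * r)) B
  refine (schatten_star_mul_le _ _ hp).trans ?_
  calc _ ≤ √(F * a ^ 2) * √(F * b ^ 2) :=
        mul_le_mul (Real.sqrt_le_sqrt hAs) (Real.sqrt_le_sqrt hBs) (Real.sqrt_nonneg _)
          (Real.sqrt_nonneg _)
    _ = (√F * √F) * (a * b) := by
        rw [Real.sqrt_mul hF, Real.sqrt_mul hF, Real.sqrt_sq hmA, Real.sqrt_sq hmB]; ring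
    _ = _ := by rw [Real.mul_self_sqrt hF]

end AmalgamatedNorm

/-! ### The limit ε → 0 and the counterexample -/

theorem not_forall_quadratic_le_superquadratic {s s' κ c r r' : ℝ} (hs : 0 < s) (hs' : 0 ≤ s')
    (hκ : 0 ≤ κ) (hc : 0 < c) (hr : r.HolderConjugate r')
    (h : ∀ ε : ℝ, 0 < ε → c * ε ^ 2 + s ≤
      (s ^ (1 / r - 1 / 2) * (s + (κ * ε ^ 2) ^ r' * s') ^ (1 / r')) ^ 2) : False := by
  have hr1 : 1 < r' := hr.symm.lt
  set K := κ ^ r' * s' / s with hK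
  have hK0 : 0 ≤ K := by positivity
  -- With e = ε², the exponents of s add up to 1/2 and the right side is at most s (1 + K e^r')².
  -- Cancelling s and dividing by e leaves a bound on c that tends to 0, as r' > 1.
  have key : ∀ e : ℝ, 0 < e → c ≤ s * (2 * K * e ^ (r' - 1) + K ^ 2 * e * (e ^ (r' - 1)) ^ 2) := by
    intro e he
    have h1 := h (√e) (Real.sqrt_pos.2 he)
    rw [Real.sq_sqrt he.le] at h1
    set η := e ^ (r' - 1) with hη
    have hη0 : 0 ≤ η := Real.rpow_nonneg he.le _
    have hx : s + (κ * e) ^ r' * s' = s * (1 + K * (e * η)) := by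
      have : e ^ r' = e * η := by
        rw [hη]; nth_rw 2 [← Real.rpow_one e]
        rw [← Real.rpow_add he]; congr 1; ring
      rw [Real.mul_rpow hκ he.le, this, hK]; field_simp
    have hx0 : 0 ≤ K * (e * η) := by positivity
    have h2 : s ^ (1 / r - 1 / 2) * (s + (κ * e) ^ r' * s') ^ (1 / r') ≤
        √s * (1 + K * (e * η)) := by
      rw [hx, Real.mul_rpow hs.le (by positivity), ← mul_assoc, ← Real.rpow_add hs,
        Real.sqrt_eq_rpow, show 1 / r - 1 / 2 + 1 / r' = 1 / 2 by
          have := hr.one_div_add_one_div; rw [div_one] at this; linarith]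
      refine mul_le_mul_of_nonneg_left ?_ (Real.rpow_nonneg hs.le _)
      calc (1 + K * (e * η)) ^ (1 / r') ≤ (1 + K * (e * η)) ^ (1 : ℝ) :=
            Real.rpow_le_rpow_of_exponent_le (by linarith)
              ((div_le_one (by linarith)).2 hr1.le)
        _ = _ := Real.rpow_one _
    have h3 : (s ^ (1 / r - 1 / 2) * (s + (κ * e) ^ r' * s') ^ (1 / r')) ^ 2 ≤
        (√s * (1 + K * (e * η))) ^ 2 := by
      refine pow_le_pow_left₀ (mul_nonneg (Real.rpow_nonneg hs.le _) (Real.rpow_nonneg ?_ _)) h2 2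
      rw [hx]; positivity
    rw [mul_pow (√s), Real.sq_sqrt hs.le] at h3
    have h4 : e * c ≤ e * (s * (2 * K * η + K ^ 2 * e * η ^ 2)) := by linarith
    exact le_of_mul_le_mul_left h4 he
  have hlim : Filter.Tendsto
      (fun e : ℝ => s * (2 * K * e ^ (r' - 1) + K ^ 2 * e * (e ^ (r' - 1)) ^ 2))
      (nhdsWithin 0 (Set.Ioi 0)) (nhds 0) := by
    have h1 : ContinuousAt (fun e : ℝ => e ^ (r' - 1)) 0 :=
      Real.continuousAt_rpow_const _ _ (Or.inr (by linarith))
    have h2 : ContinuousAt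
        (fun e : ℝ => s * (2 * K * e ^ (r' - 1) + K ^ 2 * e * (e ^ (r' - 1)) ^ 2)) 0 := by
      fun_prop
    have h3 := h2.tendsto
    simp only [Real.zero_rpow (show r' - 1 ≠ 0 by linarith)] at h3
    simp only [mul_zero, zero_mul, add_zero] at h3
    exact h3.mono_left nhdsWithin_le_nhds
  have := ge_of_tendsto hlim (by
    filter_upwards [self_mem_nhdsWithin] with e he using key e he)
  linarith

section Counterexample

variable {N : StarSubalgebra ℂ (H →L[ℂ] H)} {E : (H →L[ℂ] H) →CP (H →L[ℂ] H)} {p : ℝ}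

theorem not_uniformConvexity (hN_bot : N ≠ ⊥) (hN_top : N ≠ ⊤) (hE : IsCondExp N E)
    (hEf : IsFaithful E) (hp : 1 < p) (hp2 : p < 2) : ¬ UniformConvexity N E p := by
  intro hUC
  have hp0 : 0 < p := by linarith
  obtain ⟨r, hpr, hr⟩ : ∃ r : ℝ, 1 / r = 1 / p - 1 / 2 ∧ 2 < r := by
    have h0 : 0 < 1 / p - 1 / 2 := sub_pos.2 (one_div_lt_one_div_of_lt hp0 hp2)
    refine ⟨1 / (1 / p - 1 / 2), by rw [one_div_one_div], ?_⟩
    rw [lt_div_iff₀ h0]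
    have : 1 / p < 1 := (div_lt_one hp0).2 hp
    linarith
  have hr0 : 0 < r := by linarith
  have hrr : r.HolderConjugate (r / (r - 1)) := Real.HolderConjugate.conjExponent (by linarith)
  obtain ⟨P, hPN, hP, hP0, hP1, hmin⟩ := exists_minimal_proj hN_bot
  obtain ⟨Z, hZ0, hPZ, hZQ, hEZ⟩ := hE.exists_offdiag hN_top hPN hP hP0 hP1
  have hσ := hEf.sigmaTr_isStrictlyPositive
  have hσP := hE.commute_sigmaTr hPN
  have hQN : 1 - P ∈ N := sub_mem (one_mem N) hPN
  have hQ0 : 1 - P ≠ 0 := fun h => hP1 (sub_eq_zero.1 h).symm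
  have hQ := hP.one_sub
  have hσQ := hE.commute_sigmaTr hQN
  have hQP : (1 - P) * P = 0 := by rw [sub_mul, hP.isIdempotentElem.eq, one_mul, sub_self]
  have hPQ : P * (1 - P) = 0 := by rw [mul_sub, hP.isIdempotentElem.eq, mul_one, sub_self]
  have hZP : Z * P = 0 := by rw [← hZQ, mul_assoc, hQP, mul_zero]
  obtain ⟨κ, hκ, hbound⟩ := exists_schatten_perturb_le hσ hP hP0 hσP hPZ hZQ hp hpr hrr
  have hs : 0 < (tr (sigmaTr E * P)).re := by
    refine re_tr_pos (mul_nonneg_of_commute_proj hσ.nonneg hP hσP) fun h0 => hP0 ?_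
    exact (hσ.isUnit.mul_right_eq_zero).1 h0
  have hs' : 0 ≤ (tr (sigmaTr E * (1 - P))).re :=
    re_tr_nonneg (mul_nonneg_of_commute_proj hσ.nonneg hQ hσQ)
  -- The quotient obtained from Z itself with the test pair P, 1 - P; it bounds the amalgamated norm
  -- of X - E X from below by ε κ₀.
  set κ₀ := wNorm (sigmaTr E) (ENNReal.ofReal p) Z /
    (wNorm (sigmaTr E) (ENNReal.ofReal (2 * r)) P *
      wNorm (sigmaTr E) (ENNReal.ofReal (2 * r)) (1 - P))
  have hκ₀ : 0 < κ₀ := div_pos (wNorm_pos hσ hp0 hZ0)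
    (mul_pos (wNorm_pos hσ (by positivity) hP0) (wNorm_pos hσ (by positivity) hQ0))
  refine not_forall_quadratic_le_superquadratic (c := (p - 1) * κ₀ ^ 2) hs hs' hκ
    (mul_pos (by linarith) (by positivity)) hrr fun ε hε => ?_
  set W := P + ε • Z
  have hWP : W * P = P := by
    rw [add_mul, smul_mul_assoc, hZP, smul_zero, add_zero, hP.isIdempotentElem.eq]
  have hWQ : W * (1 - P) = ε • Z := by rw [add_mul, smul_mul_assoc, hZQ, hPQ, zero_add]
  have hPW : P * star W = P := by
    have := congrArg star hWP
    rwa [star_mul, hP.isSelfAdjoint.star_eq] at this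
  have hPXP : P * (star W * W) * P = P := by
    rw [mul_assoc, mul_assoc, hWP, ← mul_assoc, hPW, hP.isIdempotentElem.eq]
  have hPXQ : P * (star W * W) * (1 - P) = ε • Z := by
    rw [mul_assoc, mul_assoc, hWQ, ← mul_assoc, hPW, mul_smul_comm, hPZ]
  have hX := hUC (star W * W) (star_mul_self_nonneg W)
  have hup : amalgNorm N E 2 (ENNReal.ofReal p) (star W * W) ≤
      (tr (sigmaTr E * P)).re ^ (1 / r - 1 / 2) *
        ((tr (sigmaTr E * P)).re + (κ * ε ^ 2) ^ (r / (r - 1)) *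
          (tr (sigmaTr E * (1 - P))).re) ^ (1 / (r / (r - 1))) := by
    refine amalgNorm_star_mul_self_le hp hr0 hpr W (by positivity) fun A hA => ?_
    obtain ⟨b, hb⟩ := hmin (star A * A) (mul_mem (star_mem hA) hA) (.star_mul_self A)
    refine hbound ε b A hε.le (hE.commute_sigmaTr hA) hb ?_
    -- The first-order term is a multiple of Tr(E(Z) A*A P), and E Z = 0.
    rw [tr_sigmaTr_mul, hE.map_mul_right hPN,
      hE.map_mul_right (mul_mem (star_mem hA) hA), hEZ, zero_mul, zero_mul, map_zero, mul_zero]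
  -- P E(X) P = E(P X P) = P, so the test pair P, P has quotient s^(1/p - 1/r) = √s.
  have hlow : (tr (sigmaTr E * P)).re ≤
      amalgNorm N E 2 (ENNReal.ofReal p) (E (star W * W)) ^ 2 := by
    have h1 := le_amalgNorm hσ hp hr0 hpr (E (star W * W)) hPN hPN hP0 hP0
    rw [← hE.bimodule P hPN P hPN, hPXP, hE.map_of_mem hPN, wNorm_proj hσ.nonneg hP hp0 hσP,
      wNorm_proj hσ.nonneg hP (by positivity) hσP, ← Real.rpow_add hs, ← Real.rpow_sub hs,
      show 1 / p - (1 / (2 * r) + 1 / (2 * r)) = 1 / 2 by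
        have : 1 / (2 * r) + 1 / (2 * r) = 1 / r := by field_simp; norm_num
        rw [this, hpr]; ring, ← Real.sqrt_eq_rpow] at h1
    calc _ = √(tr (sigmaTr E * P)).re ^ 2 := (Real.sq_sqrt hs.le).symm
      _ ≤ _ := pow_le_pow_left₀ (Real.sqrt_nonneg _) h1 2
  have hdiff : ε * κ₀ ≤ amalgNorm N E 2 (ENNReal.ofReal p) (star W * W - E (star W * W)) := by
    have h1 := le_amalgNorm hσ hp hr0 hpr (star W * W - E (star W * W)) hPN hQN hP0 hQ0
    rw [mul_sub P, sub_mul _ _ (1 - P), ← hE.bimodule P hPN (1 - P) hQN, hPXQ, ← Complex.coe_smul, map_smul,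
      hEZ, smul_zero, sub_zero, Complex.coe_smul, wNorm_real_smul _ _ hp0 hε.le, mul_div_assoc]
      at h1
    exact h1
  have hsq1 : (ε * κ₀) ^ 2 ≤
      amalgNorm N E 2 (ENNReal.ofReal p) (star W * W - E (star W * W)) ^ 2 :=
    pow_le_pow_left₀ (by positivity) hdiff 2
  have hsq2 := pow_le_pow_left₀ (amalgNorm_nonneg hp hr0 hpr _) hup 2
  have hsq3 := mul_le_mul_of_nonneg_left hsq1 (show 0 ≤ p - 1 by linarith)
  calc _ = (p - 1) * (ε * κ₀) ^ 2 + (tr (sigmaTr E * P)).re := by ring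
    _ ≤ _ := add_le_add hsq3 hlow
    _ ≤ _ := hX
    _ ≤ _ := hsq2

end Counterexample

end AmalgamatedLp
end

theorem mainTheorem12 {H : Type*} [NormedAddCommGroup H] [InnerProductSpace ℂ H]
    [FiniteDimensional ℂ H] [CompleteSpace H]
    (N : StarSubalgebra ℂ (H →L[ℂ] H)) (hN_bot : N ≠ ⊥) (hN_top : N ≠ ⊤)
    (E : (H →L[ℂ] H) →CP (H →L[ℂ] H))
    (hE : AmalgamatedLp.IsCondExp N E) (hEf : AmalgamatedLp.IsFaithful E) :
    (¬ ∀ p : ℝ, 1 ≤ p → p ≤ 2 → AmalgamatedLp.UniformConvexity N E p) ∧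
      ∀ p : ℝ, 1 < p → p < 2 → ¬ AmalgamatedLp.UniformConvexity N E p :=
  ⟨fun h => AmalgamatedLp.not_uniformConvexity hN_bot hN_top hE hEf (p := 3 / 2) (by norm_num)
    (by norm_num) (h _ (by norm_num) (by norm_num)),
  fun _ hp hp2 => AmalgamatedLp.not_uniformConvexity hN_bot hN_top hE hEf hp hp2⟩
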